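/- Let $(X^{(n)})_{n\ge 1}$ be real-valued càdlàg processes on a common probability space $(\Omega,\mathscr F,\mathbf P)$, regarded as random elements of the space $\mathbf D(\mathbb R_+;\mathbb R)$ of càdlàg functions with the Skorokhod ($J_1$) topology and its Borel $\sigma$-algebra. Write $\Delta_h f(t):=f(t+h)-f(t)$ and let $[x]$ denote the integer part of $x$. Suppose that $\sup_{n\ge1}\mathbf E\big[|X^{(n)}(0)|^{\beta}\big]<\infty$ for some $\beta>0$, and that for every $T\ge 0$ there is a constant $\theta>2$ such that: (1) $\displaystyle \sup_{k=0,1,\dots,[Tn^\theta]}\ \sup_{h\in[0,1/n^\theta]}\big|\Delta_hX^{(n)}(k/n^\theta)\big|\to 0$ in probability as $n\to\infty$; (2) there are constants $C>0$, $p\ge 1$, $m\in\{1,2,\dots\}$ and pairs $(a_i,b_i)_{1\le i\le m}$ with $a_i\ge 0$, $b_i>0$ and $\min_{1\le i\le m}\{b_i+a_i/\theta\}>1$, such that for all $n\ge1$ and $h\in(0,1)$, $$\sup_{t\in[0,T]}\mathbf E\Big[\big|\Delta_hX^{(n)}(t)\big|^p\Big]\le C\sum_{i=1}^m\frac{h^{b_i}}{n^{a_i}}.$$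 Then the sequence $(X^{(n)})_{n\ge1}$ is $C$-tight, that is, the laws of the $X^{(n)}$ on $\mathbf D(\mathbb R_+;\mathbb R)$ form a tight family, and every weak limit of a subsequence of these laws is the law of a process with continuous paths (it gives full measure to the continuous functions). -/

import Mathlib

open MeasureTheory Filter Topology
open scoped NNReal ENNReal Uniformity

/-- The set `D(ℝ₊; ℝ)` of càdlàg functions: right-continuous with left limits at every time.
(At time `0` the left-limit condition is void, because `𝓝[<] (0 : ℝ≥0) = ⊥`.) -/
structure CadlagPath where
  toFun : ℝ≥0 → ℝ
  right_continuous : ∀ t, ContinuousWithinAt toFun (Set.Ici t) t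
  left_limits : ∀ t, ∃ l : ℝ, Tendsto toFun (𝓝[<] t) (𝓝 l)

namespace CadlagPath

instance : CoeFun CadlagPath (fun _ => ℝ≥0 → ℝ) := ⟨toFun⟩

/-- The pairs `(x, y)` for which some time change `τ` (an increasing bijection of `[0, ∞)`, hence
an increasing homeomorphism fixing `0`) satisfies `sup_s |τ s - s| ≤ ε` and
`sup_{s ≤ T} |y (τ s) - x s| ≤ ε`. -/
def skorokhodEntourage (T ε : ℝ) : Set (CadlagPath × CadlagPath) :=
  {q | ∃ τ : ℝ≥0 ≃o ℝ≥0, (∀ s, dist (τ s) s ≤ ε) ∧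
    ∀ s : ℝ≥0, (s : ℝ) ≤ T → dist (q.2 (τ s)) (q.1 s) ≤ ε}

theorem skorokhodEntourage_mono {T T' ε ε' : ℝ} (hT : T' ≤ T) (hε : ε ≤ ε') :
    skorokhodEntourage T ε ⊆ skorokhodEntourage T' ε' := by
  rintro q ⟨τ, h1, h2⟩
  exact ⟨τ, fun s => (h1 s).trans hε, fun s hs => (h2 s (hs.trans hT)).trans hε⟩

/-- The sets `skorokhodEntourage T ε`, `ε > 0`, form a filter basis. -/
def skorokhodBasis : FilterBasis (CadlagPath × CadlagPath) where
  sets := {V | ∃ T ε : ℝ, 0 < ε ∧ V = skorokhodEntourage T ε}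
  nonempty := ⟨_, 0, 1, one_pos, rfl⟩
  inter_sets := by
    rintro _ _ ⟨T, ε, hε, rfl⟩ ⟨T', ε', hε', rfl⟩
    exact ⟨_, ⟨max T T', min ε ε', lt_min hε hε', rfl⟩, Set.subset_inter
      (skorokhodEntourage_mono (le_max_left _ _) (min_le_left _ _))
      (skorokhodEntourage_mono (le_max_right _ _) (min_le_right _ _))⟩

/-- The Skorokhod (J1) topology of `D(ℝ₊; ℝ)`, given through a uniformity with a countable basis.
Thus `x n → x` if and only if there are time changes `τ n` with `sup_s |τ n s - s| → 0` and
`sup_{s ≤ T} |x n (τ n s) - x s| → 0` for every `T`. -/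
instance : UniformSpace CadlagPath :=
  UniformSpace.ofCore <| UniformSpace.Core.mkOfBasis skorokhodBasis
    (by
      rintro _ ⟨T, ε, hε, rfl⟩ x
      exact ⟨OrderIso.refl _, fun s => by simpa using hε.le, fun s _ => by simpa using hε.le⟩)
    (by
      rintro _ ⟨T, ε, hε, rfl⟩
      refine ⟨_, ⟨T + ε, ε, hε, rfl⟩, ?_⟩
      rintro ⟨x, y⟩ ⟨τ, h1, h2⟩
      have key : ∀ s, dist (τ.symm s) s ≤ ε := fun s => by
        have := h1 (τ.symm s)
        rwa [τ.apply_symm_apply, dist_comm] at this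
      refine ⟨τ.symm, key, fun s hs => ?_⟩
      have h3 := abs_le.1 (show |((τ.symm s : ℝ≥0) : ℝ) - (s : ℝ)| ≤ ε from key s)
      have h4 := h2 (τ.symm s) (by linarith [h3.2])
      rwa [τ.apply_symm_apply, dist_comm] at h4)
    (by
      rintro _ ⟨T, ε, hε, rfl⟩
      refine ⟨_, ⟨T + ε, ε / 2, half_pos hε, rfl⟩, ?_⟩
      rintro ⟨x, z⟩ ⟨y, ⟨τ, h1, h2⟩, ⟨σ, k1, k2⟩⟩
      refine ⟨τ.trans σ, fun s => ?_, fun s hs => ?_⟩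
      · have := dist_triangle (σ (τ s)) (τ s) s
        have a := h1 s
        have b := k1 (τ s)
        simp only [OrderIso.trans_apply]
        linarith
      · have h3 := abs_le.1 (show |((τ s : ℝ≥0) : ℝ) - (s : ℝ)| ≤ ε / 2 from h1 s)
        have a := h2 s (by linarith)
        have b := k2 (τ s) (by linarith [h3.2])
        have := dist_triangle (z (σ (τ s))) (y (τ s)) (x s)
        simp only [OrderIso.trans_apply]
        dsimp only at a b
        linarith)

/-- `D(ℝ₊; ℝ)` carries the Borel σ-algebra of the Skorokhod topology. -/
instance : MeasurableSpace CadlagPath := borel CadlagPath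

instance : BorelSpace CadlagPath := ⟨rfl⟩

/-- `sup_{k = 0, …, [T n^θ]} sup_{0 ≤ h ≤ 1 / n^θ} |Δ_h x (k / n^θ)|`, in `[0, ∞]`, where
`Δ_h x (t) = x (t + h) - x t`. -/
noncomputable def cellOsc (T : ℝ≥0) (θ : ℝ) (n : ℕ+) (x : CadlagPath) : ℝ≥0∞ :=
  ⨆ k ∈ Finset.range (⌊T * (n : ℝ≥0) ^ θ⌋₊ + 1), ⨆ h ∈ Set.Icc (0 : ℝ≥0) (1 / (n : ℝ≥0) ^ θ),
    ‖fwdDiff h x.toFun ((k : ℝ≥0) / (n : ℝ≥0) ^ θ)‖ₑ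

end CadlagPath

/-- C-tightness of a sequence of laws on `D(ℝ₊; ℝ)`: the sequence is tight, and every weak
accumulation point (limit of a weakly convergent subsequence) is the law of a continuous
process. -/
def IsCTight (P : ℕ+ → ProbabilityMeasure CadlagPath) : Prop :=
  IsTightMeasureSet (Set.range fun n => (P n : Measure CadlagPath)) ∧
  ∀ (φ : ℕ → ℕ+) (Q : ProbabilityMeasure CadlagPath), StrictMono φ →
    Tendsto (fun j => P (φ j)) atTop (𝓝 Q) →
      ∀ᵐ x : CadlagPath ∂(Q : Measure CadlagPath), Continuous x.toFun

/-- The law on `D(ℝ₊; ℝ)` of a càdlàg process. -/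
noncomputable def pathLaw {Ω : Type*} [MeasurableSpace Ω] (μ : Measure Ω) [IsProbabilityMeasure μ]
    (Y : Ω → CadlagPath) (hY : Measurable Y) : ProbabilityMeasure CadlagPath :=
  ⟨μ.map Y, Measure.isProbabilityMeasure_map hY.aemeasurable⟩

/-! The moment bound gives Kolmogorov's condition only down to the scale `n ^ (-θ)`. For `h ≥ n ^
(-θ)` one has `n ^ (-a) ≤ h ^ (a / θ)`, so the bound is at most a constant times `h ^ γ`, for some
`γ > 1` below every `b i + a i / θ` (`sum_rpow_div_rpow_le`). Chaining over the dyadic multiples of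
`r = n ^ (-θ)` up to `H = 2 ^ R * r` then fails with probability `O(H ^ (γ - 1))`, uniformly in `n`
(`exists_measure_notMem_smallCells_le`). Below the mesh, the oscillation is controlled by the first
hypothesis. Hence for large `n`, outside an event of small probability, the path moves by at most
`w` on each cell of a grid whose mesh lies between two positive constants
(`exists_eventually_measure_notMem_smallCells_le`).

Both conclusions follow. With a bounded initial value, such a grid is a partition with gaps bounded
below and nearly constant, bounded values on its cells; this is Skorokhod's compactness criterion,
proved here with ultrafilters (`exists_ultrafilter_le_nhds`), and it yields tightness. A path with
small cells also has no jump larger than `2 * w`; as large jumps persist under small J1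
perturbations, the portmanteau theorem excludes jumps in weak limits. -/

namespace CadlagPath

/-! ### Topology and Borel structure of the Skorokhod space -/

theorem uniformity_hasBasis :
    (𝓤 CadlagPath).HasBasis (fun q : ℝ × ℝ => 0 < q.2) fun q => skorokhodEntourage q.1 q.2 := by
  refine ⟨fun V => ?_⟩
  refine (skorokhodBasis.hasBasis.mem_iff (t := V)).trans ⟨?_, ?_⟩
  · rintro ⟨_, ⟨T, ε, hε, rfl⟩, h⟩
    exact ⟨(T, ε), hε, h⟩
  · rintro ⟨⟨T, ε⟩, hε, h⟩
    exact ⟨_, ⟨T, ε, hε, rfl⟩, h⟩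

theorem nhds_hasBasis (x : CadlagPath) :
    (𝓝 x).HasBasis (fun q : ℝ × ℝ => 0 < q.2)
      fun q => {y | (x, y) ∈ skorokhodEntourage q.1 q.2} :=
  nhds_basis_uniformity' uniformity_hasBasis

/-- A countable basis makes the space pseudometrizable, so closed sets have the outer approximations
that the portmanteau theorem requires. -/
instance : (𝓤 CadlagPath).IsCountablyGenerated := by
  have : (𝓤 CadlagPath).HasAntitoneBasis
      fun n : ℕ => skorokhodEntourage n (1 / ((n : ℝ) + 1)) := by
    refine ⟨⟨fun V => ?_⟩, fun m n hmn => ?_⟩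
    · rw [uniformity_hasBasis.mem_iff]
      constructor
      · rintro ⟨⟨T, ε⟩, hε, h⟩
        obtain ⟨m, hm⟩ := exists_nat_one_div_lt hε
        obtain ⟨k, hk⟩ := exists_nat_ge T
        refine ⟨max m k, trivial, (skorokhodEntourage_mono ?_ ?_).trans h⟩
        · exact hk.trans (by exact_mod_cast le_max_right m k)
        · refine le_trans (one_div_le_one_div_of_le (by positivity) ?_) hm.le
          have : (m : ℝ) ≤ (max m k : ℕ) := by exact_mod_cast le_max_left m k
          linarith
      · rintro ⟨n, -, h⟩
        exact ⟨(n, 1 / ((n : ℝ) + 1)), by positivity, h⟩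
    · have : (m : ℝ) ≤ n := by exact_mod_cast hmn
      exact skorokhodEntourage_mono this
        (one_div_le_one_div_of_le (by positivity) (by linarith))
  exact this.isCountablyGenerated

instance : HasOuterApproxClosed CadlagPath := by
  let _ := UniformSpace.pseudoMetricSpace CadlagPath
  infer_instance

/-- A set of paths is open if every member has a neighbourhood basis element inside. -/
theorem isOpen_iff_entourage {U : Set CadlagPath} :
    IsOpen U ↔ ∀ x ∈ U, ∃ T ε : ℝ, 0 < ε ∧ ∀ y, (x, y) ∈ skorokhodEntourage T ε → y ∈ U := by
  simp only [isOpen_iff_mem_nhds, (nhds_hasBasis _).mem_iff, Prod.exists]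
  rfl

/-- Evaluation at a fixed time is not continuous, since time changes move the time. Asking for a
large value somewhere in an open interval leaves room for that displacement. -/
theorem isOpen_exists_lt_apply (t u : ℝ≥0) (a : ℝ) :
    IsOpen {x : CadlagPath | ∃ s ∈ Set.Ioo t u, a < x s} := by
  rw [isOpen_iff_entourage]
  rintro x ⟨s, ⟨h1, h2⟩, hs⟩
  have h1' : (t : ℝ) < s := h1
  have h2' : (s : ℝ) < u := h2
  obtain ⟨ε, hε, hε'⟩ : ∃ ε : ℝ, 0 < ε ∧ ε < min (x s - a) (min ((s : ℝ) - t) (u - s)) :=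
    exists_between (by simp [hs, h1', h2'])
  simp only [lt_min_iff] at hε'
  obtain ⟨e1, e2, e3⟩ := hε'
  refine ⟨s, ε, hε, ?_⟩
  rintro y ⟨τ, k1, k2⟩
  have k1 := abs_le.1 (show |((τ s : ℝ≥0) : ℝ) - (s : ℝ)| ≤ ε from k1 s)
  have k2 := abs_le.1 (show |y (τ s) - x s| ≤ ε from k2 s le_rfl)
  refine ⟨τ s, ⟨?_, ?_⟩, by linarith [k2.1]⟩
  · exact NNReal.coe_lt_coe.1 (by linarith [k1.1])
  · exact NNReal.coe_lt_coe.1 (by linarith [k1.2])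

/-- Evaluation at a fixed time is Borel measurable on the Skorokhod space. -/
theorem measurable_eval (t : ℝ≥0) : Measurable fun x : CadlagPath => x t := by
  refine measurable_of_Ioi fun a => ?_
  -- By right-continuity `x t` is recovered from values just after `t`; the rational `b` keeps the
  -- inequality strict in the limit.
  have : (fun x : CadlagPath => x t) ⁻¹' Set.Ioi a = ⋃ b : {b : ℚ // a < b},
      ⋂ k : ℕ, {x : CadlagPath | ∃ s ∈ Set.Ioo t (t + 1 / ((k : ℝ≥0) + 1)), (b : ℝ) < x s} := by
    ext x
    simp only [Set.mem_preimage, Set.mem_Ioi, Set.mem_iUnion, Set.mem_iInter, Set.mem_ofPred_eq]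
    constructor
    · intro h
      obtain ⟨b, hb, hb'⟩ := exists_rat_btwn h
      refine ⟨⟨b, hb⟩, fun k => ?_⟩
      have h1 : ∀ᶠ s in 𝓝[>] t, (b : ℝ) < x s :=
        ((x.right_continuous t).mono Set.Ioi_subset_Ici_self).eventually (lt_mem_nhds hb')
      have h2 : ∀ᶠ s in 𝓝[>] t, s ∈ Set.Ioo t (t + 1 / ((k : ℝ≥0) + 1)) :=
        Ioo_mem_nhdsGT (lt_add_of_pos_right _ (by positivity))
      obtain ⟨s, hs⟩ := (h2.and h1).exists
      exact ⟨s, hs⟩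
    · rintro ⟨⟨b, hb⟩, h⟩
      refine lt_of_lt_of_le hb (le_of_not_gt fun hlt => ?_)
      have h1 : ∀ᶠ s in 𝓝[≥] t, x s < b := (x.right_continuous t).eventually (gt_mem_nhds hlt)
      obtain ⟨u, hu, h2⟩ := (mem_nhdsGE_iff_exists_Ico_subset' (lt_add_one t)).1 h1
      have hu : (t : ℝ) < u := hu
      obtain ⟨k, hk⟩ := exists_nat_one_div_lt (sub_pos.2 hu)
      obtain ⟨s, ⟨h3, h4⟩, h5⟩ := h k
      refine lt_asymm h5 (h2 ⟨h3.le, h4.trans ?_⟩)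
      rw [← NNReal.coe_lt_coe]
      push_cast
      linarith
  rw [this]
  exact .iUnion fun b => .iInter fun k => (isOpen_exists_lt_apply _ _ _).measurableSet

end CadlagPath

theorem ENNReal.edist_zero_eq (a : ℝ≥0∞) : edist a 0 = a := by
  cases a with
  | top => rw [ENNReal.edist_eq_top_iff]; simp
  | coe a =>
    change edist a (0 : ℝ≥0) = a
    simp [edist_nndist]

theorem NNReal.exists_mem_Ico_of_lt {t : ℕ → ℝ≥0} (h0 : t 0 = 0) {N : ℕ} {s : ℝ≥0}
    (hs : s < t N) : ∃ i < N, s ∈ Set.Ico (t i) (t (i + 1)) := by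
  induction N with
  | zero => simp [h0] at hs
  | succ N ih =>
    by_cases h : s < t N
    · obtain ⟨i, hi, h⟩ := ih h
      exact ⟨i, hi.trans N.lt_succ_self, h⟩
    · exact ⟨N, N.lt_succ_self, not_lt.1 h, hs⟩

theorem NNReal.exists_mem_Ioc_of_le {t : ℕ → ℝ≥0} (h0 : t 0 = 0) {N : ℕ} {s : ℝ≥0} (hs0 : 0 < s)
    (hs : s ≤ t N) : ∃ i < N, s ∈ Set.Ioc (t i) (t (i + 1)) := by
  induction N with
  | zero => exact absurd hs0 (by simpa [h0] using hs)
  | succ N ih =>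
    by_cases h : s ≤ t N
    · obtain ⟨i, hi, h⟩ := ih h
      exact ⟨i, hi.trans N.lt_succ_self, h⟩
    · exact ⟨N, N.lt_succ_self, not_le.1 h, hs⟩

/-! ### Approximation of càdlàg paths by step functions -/

namespace CadlagPath

/-- `t 0 = 0 < t 1 < ⋯ < t N` is a partition with gaps at least `δ` such that on each cell the path
is `ε`-close to some constant of absolute value at most `M`. -/
structure IsPartition (ε δ M : ℝ) (x : CadlagPath) (N : ℕ) (t : ℕ → ℝ≥0) : Prop where
  zero : t 0 = 0
  gap : ∀ i < N, (t i : ℝ) + δ ≤ t (i + 1)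
  near : ∀ i < N, ∃ c : ℝ, |c| ≤ M ∧ ∀ s ∈ Set.Ico (t i) (t (i + 1)), |x s - c| ≤ ε

/-- The paths having a partition whose last point is within `ρ` of `T`. -/
def partitionable (T ρ ε δ M : ℝ) : Set CadlagPath :=
  {x | ∃ N t, IsPartition ε δ M x N t ∧ |(t N : ℝ) - T| ≤ ρ}

theorem IsPartition.mono {ε δ M ε' δ' M' : ℝ} {x : CadlagPath} {N : ℕ} {t : ℕ → ℝ≥0}
    (h : IsPartition ε δ M x N t) (hε : ε ≤ ε') (hδ : δ' ≤ δ) (hM : M ≤ M') :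
    IsPartition ε' δ' M' x N t where
  zero := h.zero
  gap i hi := (add_le_add_right hδ _).trans (h.gap i hi)
  near i hi :=
    let ⟨c, hc, h⟩ := h.near i hi
    ⟨c, hc.trans hM, fun s hs => (h s hs).trans hε⟩

theorem partitionable_mono {T ρ ε δ M ρ' ε' δ' M' : ℝ} (hρ : ρ ≤ ρ') (hε : ε ≤ ε') (hδ : δ' ≤ δ)
    (hM : M ≤ M') : partitionable T ρ ε δ M ⊆ partitionable T ρ' ε' δ' M' :=
  fun _ ⟨N, t, h, ht⟩ => ⟨N, t, h.mono hε hδ hM, ht.trans hρ⟩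

theorem IsPartition.le_apply {ε δ M : ℝ} {x : CadlagPath} {N : ℕ} {t : ℕ → ℝ≥0}
    (h : IsPartition ε δ M x N t) {i : ℕ} (hi : i ≤ N) : i * δ ≤ t i := by
  induction i with
  | zero => simp
  | succ i ih =>
    have := ih (by lia)
    have := h.gap i (by lia)
    push_cast
    linarith

theorem IsPartition.apply_le {ε δ M : ℝ} (hδ : 0 ≤ δ) {x : CadlagPath} {N : ℕ} {t : ℕ → ℝ≥0}
    (h : IsPartition ε δ M x N t) {i : ℕ} (hi : i ≤ N) : t i ≤ t N := by
  induction N, hi using Nat.le_induction with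
  | base => exact le_rfl
  | succ n hn ih =>
    refine (ih ⟨h.zero, fun i hi => h.gap i (by lia), fun i hi => h.near i (by lia)⟩).trans ?_
    rw [← NNReal.coe_le_coe]
    linarith [h.gap n (by lia)]

theorem IsPartition.abs_apply_le {ε δ M : ℝ} {x : CadlagPath} {N : ℕ} {t : ℕ → ℝ≥0}
    (h : IsPartition ε δ M x N t) {s : ℝ≥0} (hs : s < t N) : |x s| ≤ M + ε := by
  obtain ⟨i, hi, h'⟩ := NNReal.exists_mem_Ico_of_lt h.zero hs
  obtain ⟨c, hc, hx⟩ := h.near i hi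
  have := hx s h'
  have := abs_add_le (x s - c) c
  rw [sub_add_cancel] at this
  linarith

theorem IsPartition.append {ε δ M : ℝ} {x : CadlagPath} {N : ℕ} {t : ℕ → ℝ≥0}
    (h : IsPartition ε δ M x N t) {b : ℝ≥0} {c : ℝ}
    (hx : ∀ s ∈ Set.Ico (t N) b, |x s - c| ≤ ε) :
    IsPartition ε (min δ (b - t N)) (max M |c|) x (N + 1) (Function.update t (N + 1) b) where
  zero := by rw [Function.update_of_ne (by lia), h.zero]
  gap i hi := by
    rw [Function.update_of_ne (by lia)]
    rcases Nat.lt_succ_iff_lt_or_eq.1 hi with hi | rfl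
    · rw [Function.update_of_ne (by lia)]
      exact (add_le_add_right (min_le_left _ _) _).trans (h.gap i hi)
    · rw [Function.update_self]
      linarith [min_le_right δ (b - t i)]
  near i hi := by
    rw [Function.update_of_ne (by lia)]
    rcases Nat.lt_succ_iff_lt_or_eq.1 hi with hi | rfl
    · rw [Function.update_of_ne (by lia)]
      obtain ⟨c', hc, h⟩ := h.near i hi
      exact ⟨c', hc.trans (le_max_left _ _), h⟩
    · rw [Function.update_self]
      exact ⟨c, le_max_right _ _, hx⟩

/-- Every càdlàg path is within `ε` of a step function on a given compact interval. -/
theorem exists_isPartition (x : CadlagPath) (T : ℝ≥0) {ε : ℝ} (hε : 0 < ε) :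
    ∃ δ M : ℝ, 0 < δ ∧ ∃ N t, IsPartition ε δ M x N t ∧ t N = T := by
  -- `S` collects the endpoints reachable by a partition. Left limits show that the supremum is
  -- reached, right-continuity that it cannot be less than `T`.
  set S : Set ℝ≥0 := {b | b ≤ T ∧ ∃ δ M : ℝ, 0 < δ ∧ ∃ N t, IsPartition ε δ M x N t ∧ t N = b}
  have extend : ∀ a ∈ S, ∀ b ≤ T, a < b → ∀ c : ℝ, (∀ s ∈ Set.Ico a b, |x s - c| ≤ ε) → b ∈ S := by
    rintro a ⟨ha, δ, M, hδ, N, t, h, rfl⟩ b hb hab c hc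
    have hab' : (t N : ℝ) < b := hab
    exact ⟨hb, _, _, lt_min hδ (sub_pos.2 hab'), N + 1, _, h.append hc, by simp⟩
  have zero_mem : (0 : ℝ≥0) ∈ S :=
    ⟨zero_le, 1, 0, one_pos, 0, fun _ => 0, ⟨rfl, by simp, by simp⟩, rfl⟩
  have bdd : BddAbove S := ⟨T, fun b hb => hb.1⟩
  have hle : sSup S ≤ T := csSup_le ⟨0, zero_mem⟩ fun b hb => hb.1
  have sup_mem : sSup S ∈ S := by
    obtain ⟨l, hl⟩ := x.left_limits (sSup S)
    rcases eq_or_lt_of_le (zero_le : 0 ≤ sSup S) with h0 | h0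
    · rwa [← h0]
    have h1 : ∀ᶠ s in 𝓝[<] sSup S, |x s - l| < ε :=
      hl.eventually (Metric.ball_mem_nhds l hε)
    obtain ⟨u, hu, h2⟩ := (mem_nhdsLT_iff_exists_Ioo_subset' h0).1 h1
    obtain ⟨b, hb, hub⟩ := exists_lt_of_lt_csSup ⟨0, zero_mem⟩ hu
    rcases eq_or_lt_of_le (le_csSup bdd hb) with h3 | h3
    · rwa [← h3]
    · exact extend b hb _ hle h3 l fun s hs => (h2 ⟨hub.trans_le hs.1, hs.2⟩ : |x s - l| < ε).le
  have : sSup S = T := by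
    by_contra hne
    have hlt := lt_of_le_of_ne hle hne
    have h1 : ∀ᶠ s in 𝓝[≥] sSup S, |x s - x (sSup S)| < ε :=
      (x.right_continuous _).eventually (Metric.ball_mem_nhds _ hε)
    obtain ⟨u, hu, h2⟩ := (mem_nhdsGE_iff_exists_Ico_subset' hlt).1 h1
    have : min u T ∈ S := extend _ sup_mem _ (min_le_right _ _) (lt_min hu hlt) (x (sSup S))
      fun s hs => (h2 ⟨hs.1, hs.2.trans_le (min_le_left _ _)⟩ : |x s - _| < ε).le
    exact absurd (le_csSup bdd this) (not_le.2 (lt_min hu hlt))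
  exact (this ▸ sup_mem).2

/-- Partitionability is stable under small perturbations in the Skorokhod uniformity. -/
theorem mem_partitionable_of_mem_entourage {T ρ ε δ M η : ℝ} {x y : CadlagPath} (hδ : 0 ≤ δ)
    (hx : x ∈ partitionable T ρ ε δ M) (hxy : (x, y) ∈ skorokhodEntourage (T + ρ) η) :
    y ∈ partitionable T (ρ + η) (ε + η) (δ - 2 * η) M := by
  obtain ⟨N, t, h, ht⟩ := hx
  obtain ⟨τ, k1, k2⟩ := hxy
  have k1 : ∀ s, |((τ s : ℝ≥0) : ℝ) - (s : ℝ)| ≤ η := k1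
  -- The time change carries the partition of `x` to one of `y`; each endpoint moves by at most `η`,
  -- so a gap loses at most `2 * η`.
  refine ⟨N, fun i => τ (t i), ⟨?_, fun i hi => ?_, fun i hi => ?_⟩, ?_⟩
  · simpa [h.zero] using τ.map_bot
  · have := h.gap i hi
    linarith [(abs_le.1 (k1 (t i))).2, (abs_le.1 (k1 (t (i + 1)))).1]
  · obtain ⟨c, hc, hx⟩ := h.near i hi
    refine ⟨c, hc, fun s hs => ?_⟩
    have hs' : τ.symm s ∈ Set.Ico (t i) (t (i + 1)) :=
      ⟨(τ.le_symm_apply).2 hs.1, (τ.symm_apply_lt).2 hs.2⟩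
    have a1 := hx _ hs'
    have a2 : |y (τ (τ.symm s)) - x (τ.symm s)| ≤ η := by
      refine k2 _ ?_
      have : (τ.symm s : ℝ) ≤ t N := hs'.2.le.trans (h.apply_le hδ hi)
      linarith [(abs_le.1 ht).2]
    rw [τ.apply_symm_apply] at a2
    have := abs_add_le (y s - x (τ.symm s)) (x (τ.symm s) - c)
    rw [sub_add_sub_cancel] at this
    linarith
  · have := abs_add_le ((τ (t N) : ℝ) - t N) (t N - T)
    rw [sub_add_sub_cancel] at this
    linarith [k1 (t N)]

/-- Slightly loosened constants leave room for an open, hence Borel, set in between, so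
measurability of `partitionable` itself is never needed. -/
theorem partitionable_subset_interior {T ρ ε δ M η : ℝ} (hδ : 0 ≤ δ) (hη : 0 < η) :
    partitionable T ρ ε δ M ⊆ interior (partitionable T (ρ + η) (ε + η) (δ - 2 * η) M) :=
  fun x hx => mem_interior_iff_mem_nhds.2 <| (nhds_hasBasis x).mem_iff.2
    ⟨(T + ρ, η), hη, fun _ hy => mem_partitionable_of_mem_entourage hδ hx hy⟩

theorem closure_partitionable_subset {T ρ ε δ M η : ℝ} (hδ : 0 ≤ δ) (hη : 0 < η) :
    closure (partitionable T ρ ε δ M) ⊆ partitionable T (ρ + η) (ε + η) (δ - 2 * η) M := by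
  intro x hx
  obtain ⟨y, hy, hyx⟩ := (mem_closure_iff_nhds_basis (nhds_basis_uniformity
    uniformity_hasBasis)).1 hx (T + ρ, η) hη
  exact mem_partitionable_of_mem_entourage hδ hy hyx

/-! ### Jumps and continuity -/

/-- The paths with a jump from the left of size more than `ε` before time `T`. -/
def jumpSet (T : ℝ≥0) (ε : ℝ) : Set CadlagPath :=
  {x | ∃ s < T, ∃ᶠ u in 𝓝[<] s, ε < |x s - x u|}

/-- A time change maps left neighbourhoods of `s` to left neighbourhoods of `τ s`, so the jump
survives there with its size reduced by at most `2 * η`. -/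
theorem jumpSet_subset_interior (T : ℝ≥0) {ε ε' : ℝ} (h : ε < ε') :
    jumpSet T ε' ⊆ interior (jumpSet T ε) := by
  rintro x ⟨s, hs, hu⟩
  have hs' : (s : ℝ) < T := hs
  obtain ⟨η, hη, hη'⟩ : ∃ η : ℝ, 0 < η ∧ η < min ((ε' - ε) / 2) (T - s) :=
    exists_between (by simp [h, hs'])
  rw [lt_min_iff] at hη'
  rw [mem_interior_iff_mem_nhds, (nhds_hasBasis x).mem_iff]
  refine ⟨(s, η), hη, ?_⟩
  rintro y ⟨τ, k1, k2⟩
  have k1 : ∀ s, |((τ s : ℝ≥0) : ℝ) - (s : ℝ)| ≤ η := k1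
  refine ⟨τ s, ?_, ?_⟩
  · rw [← NNReal.coe_lt_coe]
    linarith [(abs_le.1 (k1 s)).2]
  · have ht : Tendsto τ (𝓝[<] s) (𝓝[<] (τ s)) :=
      τ.continuous.continuousWithinAt.tendsto_nhdsWithin fun u hu => τ.lt_iff_lt.2 hu
    refine ht.frequently ((hu.and_eventually self_mem_nhdsWithin).mono fun u hu => ?_)
    have hus : (u : ℝ) ≤ s := (Set.mem_Iio.1 hu.2).le
    have a1 : |y (τ s) - x s| ≤ η := k2 s le_rfl
    have a2 : |y (τ u) - x u| ≤ η := k2 u hus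
    have b1 := abs_sub_abs_le_abs_sub (x s - x u) (y (τ s) - y (τ u))
    have b2 := abs_add_le (x s - y (τ s)) (y (τ u) - x u)
    rw [abs_sub_comm (x s)] at b2
    have : x s - x u - (y (τ s) - y (τ u)) = x s - y (τ s) + (y (τ u) - x u) := by ring
    rw [this] at b1
    linarith [hu.1]

/-- Only left-continuity is at stake. Coupling horizon and threshold in one index leaves countably
many conditions, suited to an almost sure statement. -/
theorem continuous_of_forall_notMem_jumpSet {x : CadlagPath}
    (h : ∀ n : ℕ, x ∉ jumpSet n (1 / ((n : ℝ) + 1))) : Continuous x.toFun := by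
  refine continuous_iff_continuousAt.2 fun s =>
    continuousAt_iff_continuous_left'_right'.2 ⟨?_,
      (x.right_continuous s).mono Set.Ioi_subset_Ici_self⟩
  refine Metric.tendsto_nhds.2 fun ε hε => ?_
  obtain ⟨m, hm⟩ := exists_nat_one_div_lt hε
  obtain ⟨k, hk⟩ := exists_nat_gt s
  have := h (max m k)
  simp only [jumpSet, Set.mem_ofPred_eq, not_exists, not_and, not_frequently, not_lt] at this
  have hsk : s < (max m k : ℕ) := hk.trans_le (by exact_mod_cast le_max_right m k)
  filter_upwards [this s hsk] with u hu
  rw [dist_comm]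
  refine lt_of_le_of_lt hu (lt_of_le_of_lt (one_div_le_one_div_of_le (by positivity) ?_) hm)
  have : (m : ℝ) ≤ (max m k : ℕ) := by exact_mod_cast le_max_left m k
  linarith

end CadlagPath

/-! ### Piecewise affine time changes -/

/-- The increasing bijection of `[0, ∞)` that fixes `[0, a]`, maps `[a, a + b]` affinely onto
`[a, a + c]`, and has slope `1` afterwards. -/
noncomputable def NNReal.stretch (a b c : ℝ≥0) (s : ℝ≥0) : ℝ≥0 :=
  if s ≤ a then s else if s ≤ a + b then a + c / b * (s - a) else s - b + c

theorem NNReal.coe_stretch (a b c s : ℝ≥0) : (NNReal.stretch a b c s : ℝ) =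
    if (s : ℝ) ≤ a then (s : ℝ) else if (s : ℝ) ≤ a + b then a + c / b * (s - a) else s - b + c := by
  unfold NNReal.stretch
  simp only [← NNReal.coe_le_coe, NNReal.coe_add]
  split_ifs with h1 h2
  · rfl
  · have : a ≤ s := NNReal.coe_le_coe.1 (le_of_not_ge h1)
    push_cast [NNReal.coe_sub this]
    rfl
  · have : b ≤ s := NNReal.coe_le_coe.1 (by linarith [a.coe_nonneg])
    push_cast [NNReal.coe_sub this]
    rfl

theorem NNReal.stretch_stretch {a b c : ℝ≥0} (hb : 0 < b) (hc : 0 < c) (s : ℝ≥0) :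
    NNReal.stretch a c b (NNReal.stretch a b c s) = s := by
  have hb' : (0 : ℝ) < b := hb
  have hc' : (0 : ℝ) < c := hc
  rw [← NNReal.coe_inj, NNReal.coe_stretch, NNReal.coe_stretch]
  by_cases h1 : (s : ℝ) ≤ a
  · simp [h1]
  · have h1' := not_le.1 h1
    by_cases h2 : (s : ℝ) ≤ a + b
    · simp only [h1, h2, if_true, if_false]
      have e1 : 0 < (c : ℝ) / b * (s - a) := mul_pos (by positivity) (by linarith)
      have e2 : (c : ℝ) / b * (s - a) ≤ c := by
        rw [div_mul_eq_mul_div, div_le_iff₀ hb']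
        exact mul_le_mul_of_nonneg_left (by linarith) hc'.le
      rw [if_neg (by linarith), if_pos (by linarith)]
      field_simp
      ring
    · simp only [h1, h2, if_false]
      rw [if_neg (by linarith), if_neg (by linarith)]
      ring

theorem NNReal.stretch_mono (a : ℝ≥0) {b : ℝ≥0} (hb : 0 < b) (c : ℝ≥0) :
    Monotone (NNReal.stretch a b c) := by
  intro s u hsu
  have hb' : (0 : ℝ) < b := hb
  have hsu : (s : ℝ) ≤ u := hsu
  rw [← NNReal.coe_le_coe, NNReal.coe_stretch, NNReal.coe_stretch]
  have hcb : (0 : ℝ) ≤ (c : ℝ) / b := by positivity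
  have key : ∀ v : ℝ, v ≤ b → (c : ℝ) / b * v ≤ c := fun v hv => by
    rw [div_mul_eq_mul_div, div_le_iff₀ hb']
    exact mul_le_mul_of_nonneg_left hv c.coe_nonneg
  have hc := c.coe_nonneg
  split_ifs with h1 h2 h3 h4 h5 h6 h7
  · exact hsu
  · have := mul_nonneg hcb (by linarith : (0 : ℝ) ≤ u - a)
    linarith
  · linarith
  · linarith
  · exact add_le_add_right (mul_le_mul_of_nonneg_left (by linarith) hcb) _
  · have := key (s - a) (by linarith)
    linarith
  · linarith
  · linarith
  · linarith

/-- `NNReal.stretch` as an order isomorphism. -/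
noncomputable def NNReal.stretchIso (a : ℝ≥0) {b c : ℝ≥0} (hb : 0 < b) (hc : 0 < c) :
    ℝ≥0 ≃o ℝ≥0 :=
  Equiv.toOrderIso ⟨NNReal.stretch a b c, NNReal.stretch a c b, NNReal.stretch_stretch hb hc,
    NNReal.stretch_stretch hc hb⟩ (NNReal.stretch_mono a hb c) (NNReal.stretch_mono a hc b)

/-- There is a time change interpolating between two finite partitions, no further from the
identity than the partitions are from each other. -/
theorem NNReal.exists_orderIso_interpolating {l t : ℕ → ℝ≥0} {N : ℕ} {η : ℝ} (hη : 0 ≤ η)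
    (hl0 : l 0 = 0) (ht0 : t 0 = 0) (hl : ∀ i < N, l i < l (i + 1)) (ht : ∀ i < N, t i < t (i + 1))
    (hlt : ∀ i ≤ N, dist (t i) (l i) ≤ η) :
    ∃ τ : ℝ≥0 ≃o ℝ≥0, (∀ i ≤ N, τ (l i) = t i) ∧ ∀ s, dist (τ s) s ≤ η := by
  -- Slope `1` beyond `l N` is added to the induction: the image of the next cell then starts at `t
  -- N` with unchanged length, and one stretch there corrects it.
  suffices ∃ τ : ℝ≥0 ≃o ℝ≥0, (∀ i ≤ N, τ (l i) = t i) ∧ (∀ s, dist (τ s) s ≤ η) ∧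
      ∀ s ≥ l N, (τ s : ℝ) = t N + (s - l N) from
    let ⟨τ, h1, h2, _⟩ := this
    ⟨τ, h1, h2⟩
  induction N with
  | zero =>
    refine ⟨OrderIso.refl _, fun i hi => ?_, fun s => by simpa using hη, fun s _ => ?_⟩
    · rw [Nat.le_zero.1 hi, hl0, ht0]
      rfl
    · simp [hl0, ht0]
  | succ N ih =>
    obtain ⟨τ, h1, h2, h3⟩ := ih (fun i hi => hl i (by lia)) (fun i hi => ht i (by lia))
      (fun i hi => hlt i (by lia))
    have hlN := hl N N.lt_succ_self
    have htN := ht N N.lt_succ_self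
    have hlN' : (l N : ℝ) < l (N + 1) := hlN
    have htN' : (t N : ℝ) < t (N + 1) := htN
    have hb : 0 < l (N + 1) - l N := tsub_pos_of_lt hlN
    have hc : 0 < t (N + 1) - t N := tsub_pos_of_lt htN
    set σ := NNReal.stretchIso (t N) hb hc
    have hσ : ∀ s : ℝ≥0, (σ s : ℝ) = if (s : ℝ) ≤ t N then (s : ℝ) else
        if (s : ℝ) ≤ t N + (l (N + 1) - l N) then
          t N + (t (N + 1) - t N) / (l (N + 1) - l N) * (s - t N)
        else s - (l (N + 1) - l N) + (t (N + 1) - t N) := fun s => by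
      rw [← NNReal.coe_sub hlN.le, ← NNReal.coe_sub htN.le]
      exact NNReal.coe_stretch _ _ _ s
    have hmono : ∀ i ≤ N, t i ≤ t N := fun i hi => by
      have : ∀ k, i + k ≤ N → t i ≤ t (i + k) := fun k => by
        induction k with
        | zero => simp
        | succ k ih => exact fun hk => (ih (by lia)).trans (ht _ (by lia)).le
      obtain ⟨k, rfl⟩ := Nat.exists_eq_add_of_le hi
      exact this k le_rfl
    have e1 := abs_le.1 (show |(t N : ℝ) - l N| ≤ η from hlt N (by lia))
    have e2 := abs_le.1 (show |(t (N + 1) : ℝ) - l (N + 1)| ≤ η from hlt (N + 1) le_rfl)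
    have hd : (0 : ℝ) < l (N + 1) - l N := by linarith
    have last : ∀ s ≥ l (N + 1), (σ (τ s) : ℝ) = t (N + 1) + (s - l (N + 1)) := fun s hs => by
      have hs' : (l (N + 1) : ℝ) ≤ s := hs
      rw [hσ, h3 s (hlN.le.trans hs), if_neg (by linarith)]
      split_ifs with h
      · have : (s : ℝ) = l (N + 1) := by linarith
        rw [this]
        field_simp
        ring
      · ring
    refine ⟨τ.trans σ, fun i hi => ?_, fun s => ?_, last⟩
    · rcases Nat.le_succ_iff.1 hi with hi | rfl
      · rw [← NNReal.coe_inj]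
        simp only [OrderIso.trans_apply]
        rw [hσ, h1 i hi, if_pos (by exact_mod_cast hmono i hi)]
      · rw [← NNReal.coe_inj]
        exact (last _ le_rfl).trans (by simp)
    · change |(σ (τ s) : ℝ) - s| ≤ η
      rcases le_total s (l N) with h | h
      · have : τ s ≤ t N := h1 N le_rfl ▸ τ.monotone h
        rw [hσ, if_pos (by exact_mod_cast this)]
        exact h2 s
      rcases le_total s (l (N + 1)) with h' | h'
      · have h : (l N : ℝ) ≤ s := h
        have h' : (s : ℝ) ≤ l (N + 1) := h'
        rcases eq_or_lt_of_le h with h0 | h0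
        · rw [hσ, h3 s (by exact_mod_cast h), ← h0, if_pos (by linarith)]
          exact abs_le.2 ⟨by linarith, by linarith⟩
        rw [hσ, h3 s (by exact_mod_cast h), if_neg (by linarith), if_pos (by linarith)]
        -- In the barycentric coordinate `w` the displacement at `s` is a convex combination of
        -- those at the two endpoints, each at most `η` in absolute value.
        set w : ℝ := (s - l N) / (l (N + 1) - l N)
        have w0 : 0 ≤ w := div_nonneg (by linarith) hd.le
        have w1 : w ≤ 1 := (div_le_one hd).2 (by linarith)
        have hw : (s : ℝ) = l N + w * (l (N + 1) - l N) := by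
          simp only [w]
          field_simp
          ring
        have : (t N : ℝ) + (t (N + 1) - t N) / (l (N + 1) - l N) * (t N + (s - l N) - t N) - s
            = (1 - w) * (t N - l N) + w * (t (N + 1) - l (N + 1)) := by
          rw [hw]
          field_simp
          ring
        rw [this, abs_le]
        constructor <;> nlinarith
      · rw [last s h', add_sub_assoc, sub_sub_cancel_left, ← sub_eq_add_neg]
        exact abs_le.2 e2

/-! ### Skorokhod's compactness criterion -/

/-- An ultrafilter limit of a real function with eventually bounded values. -/
theorem Ultrafilter.exists_tendsto_of_eventually_mem_compact {α β : Type*} [TopologicalSpace β]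
    (U : Ultrafilter α) {K : Set β} (hK : IsCompact K) {f : α → β} (h : ∀ᶠ x in U, f x ∈ K) :
    ∃ l, Tendsto f U (𝓝 l) := by
  obtain ⟨l, -, hl⟩ := isCompact_iff_ultrafilter_le_nhds'.1 hK (U.map f) h
  exact ⟨l, hl⟩

/-- A function admits a one-sided (or any filtered) limit if its oscillation along the filter
vanishes. -/
theorem exists_tendsto_of_osc {α : Type*} {F : Filter α} [NeBot F] {f : α → ℝ}
    (h : ∀ ε > 0, ∃ s ∈ F, ∀ u ∈ s, ∀ v ∈ s, |f u - f v| ≤ ε) : ∃ l, Tendsto f F (𝓝 l) := by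
  refine CompleteSpace.complete (Metric.cauchy_iff.2 ⟨inferInstance, fun ε hε => ?_⟩)
  obtain ⟨s, hs, h⟩ := h (ε / 2) (half_pos hε)
  refine ⟨f '' s, image_mem_map hs, ?_⟩
  rintro _ ⟨u, hu, rfl⟩ _ ⟨v, hv, rfl⟩
  exact (h u hu v hv).trans_lt (half_lt_self hε)

namespace CadlagPath

/-- A function with arbitrarily small oscillation on the cells of suitable partitions is càdlàg. -/
def ofPartitions (y : ℝ≥0 → ℝ)
    (h : ∀ ε > 0, ∀ T : ℝ≥0, ∃ (N : ℕ) (l : ℕ → ℝ≥0), l 0 = 0 ∧ T < l N ∧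
      ∀ i < N, ∀ s ∈ Set.Ico (l i) (l (i + 1)), ∀ s' ∈ Set.Ico (l i) (l (i + 1)),
        |y s - y s'| ≤ ε) : CadlagPath where
  toFun := y
  right_continuous t := by
    refine Metric.tendsto_nhds.2 fun ε hε => ?_
    obtain ⟨N, l, h0, hT, hl⟩ := h (ε / 2) (half_pos hε) t
    obtain ⟨i, hi, ht⟩ := NNReal.exists_mem_Ico_of_lt h0 hT
    filter_upwards [Ico_mem_nhdsGE ht.2] with u hu
    exact (hl i hi u ⟨ht.1.trans hu.1, hu.2⟩ t ht).trans_lt (half_lt_self hε)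
  left_limits t := by
    rcases eq_or_ne t 0 with rfl | ht0
    · exact ⟨0, by simp [nhdsWithin]⟩
    have ht0 := pos_iff_ne_zero.2 ht0
    have : NeBot (𝓝[<] t) := nhdsLT_neBot_of_exists_lt ⟨0, ht0⟩
    refine exists_tendsto_of_osc fun ε hε => ?_
    obtain ⟨N, l, h0, hT, hl⟩ := h ε hε t
    obtain ⟨i, hi, h1, h2⟩ := NNReal.exists_mem_Ioc_of_le h0 ht0 hT.le
    exact ⟨Set.Ioo (l i) t, Ioo_mem_nhdsLT h1, fun u hu v hv =>
      hl i hi u ⟨hu.1.le, hu.2.trans_le h2⟩ v ⟨hv.1.le, hv.2.trans_le h2⟩⟩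

/-- Partitions of the paths in an ultrafilter of partitionable paths have a common number of points
and converge. -/
theorem exists_limit_partition (U : Ultrafilter CadlagPath) {T ρ ε δ M : ℝ} (hδ : 0 < δ)
    (hU : ∀ᶠ x in U, x ∈ partitionable T ρ ε δ M) :
    ∃ (N : ℕ) (t : CadlagPath → ℕ → ℝ≥0) (l : ℕ → ℝ≥0),
      (∀ᶠ x in U, IsPartition ε δ M x N (t x)) ∧
      (∀ i ≤ N, Tendsto (fun x => t x i) U (𝓝 (l i))) ∧
      l 0 = 0 ∧ (∀ i < N, l i < l (i + 1)) ∧ |(l N : ℝ) - T| ≤ ρ := by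
  -- Gaps of at least `δ` force `N * δ ≤ T + ρ`; among finitely many values of `N` the ultrafilter
  -- selects one.
  obtain ⟨B, hB⟩ := exists_nat_gt ((T + ρ) / δ)
  have h1 : ∀ᶠ x in U, ∃ N ∈ Set.Iio B, ∃ t, IsPartition ε δ M x N t ∧ |(t N : ℝ) - T| ≤ ρ := by
    filter_upwards [hU] with x ⟨N, t, h, ht⟩
    refine ⟨N, ?_, t, h, ht⟩
    have := h.le_apply le_rfl
    have h2 : (N : ℝ) ≤ (T + ρ) / δ := (le_div_iff₀ hδ).2 (by linarith [(abs_le.1 ht).2])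
    exact_mod_cast h2.trans_lt hB
  obtain ⟨N, -, h1⟩ := (Ultrafilter.eventually_exists_mem_iff (Set.finite_Iio B)).1 h1
  choose! t ht using fun (x : CadlagPath)
    (h : ∃ t, IsPartition ε δ M x N t ∧ |(t N : ℝ) - T| ≤ ρ) => h
  have h2 := h1.mono ht
  have h3 : ∀ i ≤ N, ∃ l, Tendsto (fun x => t x i) U (𝓝 l) := fun i hi =>
    U.exists_tendsto_of_eventually_mem_compact (isCompact_Icc (a := 0) (b := (T + ρ).toNNReal)) <|
      h2.mono fun x hx => by
        refine ⟨zero_le, NNReal.le_toNNReal_of_coe_le ?_⟩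
        have : (t x i : ℝ) ≤ t x N := hx.1.apply_le hδ.le hi
        linarith [(abs_le.1 hx.2).2]
  choose! l hl using h3
  have hl' : ∀ i ≤ N, Tendsto (fun x => (t x i : ℝ)) U (𝓝 (l i)) := fun i hi =>
    NNReal.tendsto_coe.2 (hl i hi)
  refine ⟨N, t, l, h2.mono fun x hx => hx.1, hl, ?_, fun i hi => ?_, ?_⟩
  · refine tendsto_nhds_unique (hl 0 N.zero_le) (tendsto_const_nhds.congr' ?_)
    exact h2.mono fun x hx => hx.1.zero.symm
  · have := le_of_tendsto_of_tendsto ((hl' i hi.le).add_const δ) (hl' (i + 1) hi)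
      (h2.mono fun x hx => hx.1.gap i hi)
    exact NNReal.coe_lt_coe.1 (by linarith)
  · exact le_of_tendsto ((hl' N le_rfl).sub_const T).abs (h2.mono fun x hx => hx.2)

theorem IsPartition.abs_sub_le {ε δ M : ℝ} {x : CadlagPath} {N : ℕ} {t : ℕ → ℝ≥0}
    (h : IsPartition ε δ M x N t) {i : ℕ} (hi : i < N) {s s' : ℝ≥0}
    (hs : s ∈ Set.Ico (t i) (t (i + 1))) (hs' : s' ∈ Set.Ico (t i) (t (i + 1))) :
    |x s - x s'| ≤ 2 * ε := by
  obtain ⟨c, -, hx⟩ := h.near i hi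
  have := _root_.abs_sub_le (x s) c (x s')
  have := hx s hs
  have := hx s' hs'
  have := abs_sub_comm (x s') c
  linarith

/-- Skorokhod's compactness criterion, for ultrafilters. -/
theorem exists_ultrafilter_le_nhds (U : Ultrafilter CadlagPath) {δ M : ℕ → ℝ} (hδ : ∀ j, 0 < δ j)
    (hU : ∀ j : ℕ, ∀ᶠ x in U, x ∈ partitionable j 1 (1 / ((j : ℝ) + 1)) (δ j) (M j)) :
    ∃ y, (U : Filter CadlagPath) ≤ 𝓝 y := by
  choose N t l hpart hlim hl0 hlt hlN using fun j => exists_limit_partition U (hδ j) (hU j)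
  have hlN' : ∀ (j : ℕ) (T : ℝ), T + 1 < j → T < l j (N j) := fun j T hT => by
    linarith [(abs_le.1 (hlN j)).1]
  have eps : ∀ ε > 0, ∀ T : ℝ, ∃ j : ℕ, T + 1 < j ∧ 1 / ((j : ℝ) + 1) < ε := fun ε hε T => by
    obtain ⟨m, hm⟩ := exists_nat_one_div_lt hε
    obtain ⟨k, hk⟩ := exists_nat_gt (T + 1)
    have h1 : (m : ℝ) ≤ (max m k : ℕ) := by exact_mod_cast le_max_left m k
    have h2 : (k : ℝ) ≤ (max m k : ℕ) := by exact_mod_cast le_max_right m k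
    exact ⟨max m k, by linarith,
      (one_div_le_one_div_of_le (by positivity) (by linarith)).trans_lt hm⟩
  have hg : ∀ s : ℝ≥0, ∃ g, Tendsto (fun x : CadlagPath => x s) U (𝓝 g) := fun s => by
    obtain ⟨j, hj, -⟩ := eps 1 one_pos s
    refine U.exists_tendsto_of_eventually_mem_compact
      (isCompact_Icc (a := -(M j + 1 / ((j : ℝ) + 1))) (b := M j + 1 / ((j : ℝ) + 1))) ?_
    have : s < l j (N j) := NNReal.coe_lt_coe.1 (hlN' j s hj)
    filter_upwards [hpart j, (hlim j (N j) le_rfl).eventually (lt_mem_nhds this)] with x hx hs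
    exact abs_le.1 (hx.abs_apply_le hs)
  choose g hg using hg
  have mem_cell : ∀ j, ∀ i < N j, ∀ s ∈ Set.Ioo (l j i) (l j (i + 1)),
      ∀ᶠ x in U, s ∈ Set.Ico (t j x i) (t j x (i + 1)) := fun j i hi s hs => by
    filter_upwards [(hlim j i hi.le).eventually (gt_mem_nhds hs.1),
      (hlim j (i + 1) hi).eventually (lt_mem_nhds hs.2)] with x h1 h2
    exact ⟨h1.le, h2⟩
  -- A point strictly inside a limit cell eventually lies in the corresponding cell of `x`, so the
  -- oscillation bound passes to the pointwise limit `g`.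
  have hosc : ∀ j, ∀ i < N j, ∀ s ∈ Set.Ioo (l j i) (l j (i + 1)),
      ∀ s' ∈ Set.Ioo (l j i) (l j (i + 1)), |g s - g s'| ≤ 2 * (1 / ((j : ℝ) + 1)) :=
    fun j i hi s hs s' hs' => by
      refine le_of_tendsto ((hg s).sub (hg s')).abs ?_
      filter_upwards [hpart j, mem_cell j i hi s hs, mem_cell j i hi s' hs'] with x hx h1 h2
      exact hx.abs_sub_le hi h1 h2
  -- At the limit partition points `g` is uncontrolled; its right limits provide the càdlàg
  -- candidate.
  have hy : ∀ s : ℝ≥0, ∃ y, Tendsto g (𝓝[>] s) (𝓝 y) := fun s =>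
    exists_tendsto_of_osc fun ε hε => by
      obtain ⟨j, hj, hj'⟩ := eps (ε / 2) (half_pos hε) s
      obtain ⟨i, hi, hs⟩ := NNReal.exists_mem_Ico_of_lt (hl0 j)
        (NNReal.coe_lt_coe.1 (hlN' j s hj))
      refine ⟨_, Ioo_mem_nhdsGT hs.2, fun u hu v hv => ?_⟩
      refine (hosc j i hi u ⟨hs.1.trans_lt hu.1, hu.2⟩ v ⟨hs.1.trans_lt hv.1, hv.2⟩).trans ?_
      linarith
  choose y hy using hy
  have hyg : ∀ j, ∀ i < N j, ∀ s ∈ Set.Ico (l j i) (l j (i + 1)),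
      ∀ s' ∈ Set.Ioo (l j i) (l j (i + 1)), |y s - g s'| ≤ 2 * (1 / ((j : ℝ) + 1)) :=
    fun j i hi s hs s' hs' => by
      refine le_of_tendsto ((hy s).sub_const (g s')).abs ?_
      filter_upwards [Ioo_mem_nhdsGT hs.2] with u hu
      exact hosc j i hi u ⟨hs.1.trans_lt hu.1, hu.2⟩ s' hs'
  -- Pointwise convergence is needed at one interior time per cell only; the oscillation bounds
  -- cover the rest of the cell.
  choose! mid hmid using fun (j i : ℕ) (hi : i < N j) => exists_between (hlt j i hi)
  have hmid : ∀ j, ∀ i < N j, mid j i ∈ Set.Ioo (l j i) (l j (i + 1)) := hmid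
  let z : CadlagPath := ofPartitions y fun ε hε T => by
    obtain ⟨j, hj, hj'⟩ := eps (ε / 4) (by positivity) T
    refine ⟨N j, l j, hl0 j, NNReal.coe_lt_coe.1 (hlN' j T hj), fun i hi s hs s' hs' => ?_⟩
    have h1 := hyg j i hi s hs _ (hmid j i hi)
    have h2 := hyg j i hi s' hs' _ (hmid j i hi)
    rw [abs_sub_comm] at h2
    have := abs_sub_le (y s) (g (mid j i)) (y s')
    linarith
  refine ⟨z, (nhds_hasBasis z).ge_iff.2 ?_⟩
  rintro ⟨T, ε⟩ (hε : 0 < ε)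
  -- The comparisons of `x (τ s)`, `x (mid j i)`, `g (mid j i)` and `y s` cost `2`, `1` and `2`
  -- times `1 / (j + 1)`.
  obtain ⟨j, hj, hj'⟩ := eps (ε / 5) (by positivity) T
  have hj0 : 0 < 1 / ((j : ℝ) + 1) := by positivity
  have e1 : ∀ᶠ x in U, ∀ i ∈ Finset.range (N j + 1), dist (t j x i) (l j i) ≤ ε :=
    (Finset.eventually_all _).2 fun i hi =>
      ((hlim j i (by simpa [Nat.lt_succ_iff] using hi)).eventually
        (Metric.closedBall_mem_nhds _ hε))
  have e2 : ∀ᶠ x : CadlagPath in U, ∀ i ∈ Finset.range (N j),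
      |x (mid j i) - g (mid j i)| ≤ 1 / ((j : ℝ) + 1) :=
    (Finset.eventually_all _).2 fun i hi =>
      (hg (mid j i)).eventually (Metric.closedBall_mem_nhds _ hj0)
  have e3 : ∀ᶠ x in U, ∀ i ∈ Finset.range (N j), mid j i ∈ Set.Ico (t j x i) (t j x (i + 1)) :=
    (Finset.eventually_all _).2 fun i hi =>
      mem_cell j i (by simpa using hi) _ (hmid j i (by simpa using hi))
  filter_upwards [hpart j, e1, e2, e3] with x hx e1 e2 e3
  simp only [Finset.mem_range, Nat.lt_succ_iff] at e1 e2 e3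
  obtain ⟨τ, h1, h2⟩ := NNReal.exists_orderIso_interpolating hε.le (hl0 j) hx.zero (hlt j)
    (fun i hi => NNReal.coe_lt_coe.1 (by linarith [hx.gap i hi, hδ j])) e1
  refine ⟨τ, h2, fun s hs => ?_⟩
  obtain ⟨i, hi, hs'⟩ := NNReal.exists_mem_Ico_of_lt (hl0 j)
    (NNReal.coe_lt_coe.1 (hs.trans_lt (hlN' j T hj)))
  have hτ : τ s ∈ Set.Ico (t j x i) (t j x (i + 1)) := by
    rw [← h1 i hi.le, ← h1 (i + 1) hi]
    exact ⟨τ.monotone hs'.1, τ.strictMono hs'.2⟩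
  have a1 := hx.abs_sub_le hi hτ (e3 i hi)
  have a2 := e2 i hi
  have a3 := hyg j i hi s hs' _ (hmid j i hi)
  rw [abs_sub_comm] at a3
  have b1 := abs_sub_le (x (τ s)) (x (mid j i)) (g (mid j i))
  have b2 := abs_sub_le (x (τ s)) (g (mid j i)) (y s)
  change |x (τ s) - y s| ≤ ε
  linarith

/-- Skorokhod's compactness criterion. -/
theorem isCompact_closure_iInter_partitionable {δ M : ℕ → ℝ} (hδ : ∀ j, 0 < δ j) :
    IsCompact (closure (⋂ j : ℕ,
      interior (partitionable j (1 / 2) (1 / (2 * ((j : ℝ) + 1))) (δ j) (M j)))) := by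
  set S := ⋂ j : ℕ, interior (partitionable j (1 / 2) (1 / (2 * ((j : ℝ) + 1))) (δ j) (M j))
  have hS : ∀ j : ℕ, closure S ⊆
      partitionable j 1 (1 / ((j : ℝ) + 1)) (δ j / 2) (M j) := fun j x hx => by
    -- Passing to the closure costs `η`: the tolerances at most double and at least half of the gap
    -- `δ j` remains.
    set η := min (1 / (2 * ((j : ℝ) + 1))) (δ j / 4)
    have hη : 0 < η := lt_min (by positivity) (by linarith [hδ j])
    have h1 : η ≤ 1 / (2 * ((j : ℝ) + 1)) := min_le_left _ _
    have h2 : η ≤ δ j / 4 := min_le_right _ _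
    have h3 : 1 / (2 * ((j : ℝ) + 1)) ≤ 1 / 2 :=
      one_div_le_one_div_of_le two_pos (by linarith [j.cast_nonneg (α := ℝ)])
    have h4 : 1 / ((j : ℝ) + 1) = 1 / (2 * ((j : ℝ) + 1)) + 1 / (2 * ((j : ℝ) + 1)) := by
      field_simp
      norm_num
    have h5 := closure_partitionable_subset (hδ j).le hη
      (closure_mono ((Set.iInter_subset _ j).trans interior_subset) hx)
    exact partitionable_mono (by linarith) (by linarith) (by linarith) le_rfl h5
  refine isCompact_iff_ultrafilter_le_nhds'.2 fun U hU => ?_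
  obtain ⟨y, hy⟩ := exists_ultrafilter_le_nhds U (fun j => half_pos (hδ j))
    fun j => Filter.mem_of_superset hU (hS j)
  exact ⟨y, isClosed_closure.mem_of_tendsto (f := id) (b := U) hy hU, hy⟩

end CadlagPath

/-! ### Criteria for tightness and for continuous weak limits -/

namespace CadlagPath

theorem partitionable_subset_interior_of_lt {T ρ ρ' ε ε' δ δ' M M' : ℝ} (hδ : 0 ≤ δ) (hρ : ρ < ρ')
    (hε : ε < ε') (hδ' : δ' < δ) (hM : M ≤ M') :
    partitionable T ρ ε δ M ⊆ interior (partitionable T ρ' ε' δ' M') := by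
  obtain ⟨η, hη, h⟩ : ∃ η : ℝ, 0 < η ∧ η < min (min (ρ' - ρ) (ε' - ε)) ((δ - δ') / 2) :=
    exists_between (by simp [hρ, hε, hδ'])
  simp only [lt_min_iff] at h
  exact (partitionable_subset_interior hδ hη).trans
    (interior_mono (partitionable_mono (by linarith) (by linarith) (by linarith) hM))

/-- Every path is partitionable for some gap and bound, so these complements decrease to the empty
set. This handles the finitely many exceptional laws in the tightness criterion. -/
theorem eventually_measure_compl_interior_partitionable_le (ν : Measure CadlagPath)
    [IsFiniteMeasure ν] (T : ℝ≥0) {ρ ε : ℝ} (hρ : 0 < ρ) (hε : 0 < ε) {η : ℝ≥0∞} (hη : 0 < η) :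
    ∀ᶠ k : ℕ in atTop, ν (interior (partitionable T ρ ε (1 / ((k : ℝ) + 1)) k))ᶜ ≤ η := by
  have hmono : Monotone fun k : ℕ => interior (partitionable T ρ ε (1 / ((k : ℝ) + 1)) k) :=
    fun m n hmn => by
      have : (m : ℝ) ≤ n := by exact_mod_cast hmn
      exact interior_mono (partitionable_mono le_rfl le_rfl
        (one_div_le_one_div_of_le (by positivity) (by linarith)) this)
  have hlim := tendsto_measure_iInter_atTop (μ := ν)
    (s := fun k : ℕ => (interior (partitionable T ρ ε (1 / ((k : ℝ) + 1)) k))ᶜ)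
    (fun k => isOpen_interior.measurableSet.compl.nullMeasurableSet)
    (fun m n hmn => Set.compl_subset_compl.2 (hmono hmn)) ⟨0, measure_ne_top _ _⟩
  have hempty : ⋂ k : ℕ, (interior (partitionable T ρ ε (1 / ((k : ℝ) + 1)) k))ᶜ = ∅ := by
    refine Set.eq_empty_of_forall_notMem fun x hx => ?_
    obtain ⟨δ, M, hδ, N, t, h, ht⟩ := exists_isPartition x T (half_pos hε)
    obtain ⟨m, hm⟩ := exists_nat_one_div_lt hδ
    obtain ⟨k, hk⟩ := exists_nat_ge M
    have h1 : (m : ℝ) ≤ (max m k : ℕ) := by exact_mod_cast le_max_left m k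
    have h2 : (k : ℝ) ≤ (max m k : ℕ) := by exact_mod_cast le_max_right m k
    refine Set.mem_iInter.1 hx (max m k) (partitionable_subset_interior_of_lt (ρ := 0) hδ.le hρ
      (half_lt_self hε) ((one_div_le_one_div_of_le (by positivity) ?_).trans_lt hm)
      (hk.trans h2) ⟨N, t, h, by simp [ht]⟩)
    linarith
  rw [hempty, measure_empty] at hlim
  exact hlim.eventually_le_const hη

/-- A family of laws is tight as soon as all but finitely many of its members give most of their
mass to paths that are well partitionable. -/
theorem isTightMeasureSet_of_partitionable {ι : Type*} (P : ι → Measure CadlagPath)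
    [∀ n, IsFiniteMeasure (P n)]
    (h : ∀ T : ℝ≥0, ∀ ε > 0, ∀ η > 0, ∃ δ > 0, ∃ M : ℝ,
      ∀ᶠ n in cofinite, P n (partitionable T (1 / 4) ε δ M)ᶜ ≤ η) :
    IsTightMeasureSet (Set.range P) := by
  have key : ∀ T : ℝ≥0, ∀ ε > 0, ∀ η > 0, ∃ δ > 0, ∃ M : ℝ,
      ∀ n, P n (interior (partitionable T (1 / 2) ε δ M))ᶜ ≤ η := fun T ε hε η hη => by
    obtain ⟨δ, hδ, M, hM⟩ := h T (ε / 2) (half_pos hε) η hη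
    have h1 : ∀ᶠ k : ℕ in atTop, ∀ n ∈ {n | ¬ P n (partitionable T (1 / 4) (ε / 2) δ M)ᶜ ≤ η},
        P n (interior (partitionable T (1 / 2) ε (1 / ((k : ℝ) + 1)) k))ᶜ ≤ η :=
      (eventually_all_finite hM).2 fun n _ =>
        eventually_measure_compl_interior_partitionable_le _ T (by norm_num) hε hη
    have h2 : ∀ᶠ k : ℕ in atTop, 1 / ((k : ℝ) + 1) < δ :=
      tendsto_one_div_add_atTop_nhds_zero_nat.eventually (gt_mem_nhds hδ)
    have h3 : ∀ᶠ k : ℕ in atTop, M ≤ k :=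
      tendsto_natCast_atTop_atTop.eventually (eventually_ge_atTop M)
    obtain ⟨k, h1, h2, h3⟩ := (h1.and (h2.and h3)).exists
    refine ⟨1 / ((k : ℝ) + 1), by positivity, k, fun n => ?_⟩
    by_cases hn : P n (partitionable T (1 / 4) (ε / 2) δ M)ᶜ ≤ η
    · refine (measure_mono (Set.compl_subset_compl.2 ?_)).trans hn
      exact partitionable_subset_interior_of_lt hδ.le (by norm_num) (half_lt_self hε) h2 h3
    · exact h1 n hn
  rw [isTightMeasureSet_iff_exists_isCompact_measure_compl_le]
  intro η hη
  obtain ⟨η', hη', hsum⟩ := ENNReal.exists_pos_sum_of_countable' hη.ne' ℕ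
  choose δ hδ M hM using fun j : ℕ =>
    key j (1 / (2 * ((j : ℝ) + 1))) (by positivity) (η' j) (hη' j)
  refine ⟨_, isCompact_closure_iInter_partitionable (M := M) hδ, ?_⟩
  rintro _ ⟨n, rfl⟩
  refine (measure_mono (Set.compl_subset_compl.2 subset_closure)).trans ?_
  rw [Set.compl_iInter]
  refine (measure_iUnion_le _).trans ((ENNReal.tsum_le_tsum fun j => ?_).trans hsum.le)
  simpa using hM j n

/-- Weak limits of laws for which jumps become asymptotically negligible live on continuous
paths. -/
theorem ae_continuous_of_tendsto {Q : ProbabilityMeasure CadlagPath}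
    {P : ℕ → ProbabilityMeasure CadlagPath} (hP : Tendsto P atTop (𝓝 Q))
    (h : ∀ T : ℝ≥0, ∀ ε > 0, Tendsto (fun n => (P n : Measure CadlagPath) (jumpSet T ε)) atTop
      (𝓝 0)) :
    ∀ᵐ x : CadlagPath ∂(Q : Measure CadlagPath), Continuous x.toFun := by
  have key : ∀ n : ℕ, (Q : Measure CadlagPath) (jumpSet n (1 / ((n : ℝ) + 1))) = 0 := fun n => by
    have hε : (0 : ℝ) < 1 / ((n : ℝ) + 1) := by positivity
    refine le_antisymm ?_ zero_le
    calc (Q : Measure CadlagPath) (jumpSet n (1 / ((n : ℝ) + 1)))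
        ≤ (Q : Measure CadlagPath) (interior (jumpSet n (1 / ((n : ℝ) + 1) / 2))) :=
          measure_mono (jumpSet_subset_interior n (half_lt_self hε))
      _ ≤ liminf (fun j => (P j : Measure CadlagPath)
            (interior (jumpSet n (1 / ((n : ℝ) + 1) / 2)))) atTop :=
          ProbabilityMeasure.le_liminf_measure_open_of_tendsto hP isOpen_interior
      _ ≤ liminf (fun j => (P j : Measure CadlagPath)
            (jumpSet n (1 / ((n : ℝ) + 1) / 2))) atTop :=
          liminf_le_liminf (.of_forall fun j => measure_mono interior_subset)
      _ = 0 := (h n _ (half_pos hε)).liminf_eq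
  filter_upwards [ae_all_iff.2 fun n => measure_eq_zero_iff_ae_notMem.1 (key n)] with x hx
  exact continuous_of_forall_notMem_jumpSet hx

/-! ### Paths with small cells and dyadic chaining -/

/-- The paths that move by at most `w` from the left endpoint on each cell
`[i H, (i + 1) H]` that meets `[0, T]`. -/
def smallCells (T H : ℝ≥0) (w : ℝ) : Set CadlagPath :=
  {x | ∀ i : ℕ, i * H ≤ T → ∀ s ∈ Set.Icc (i * H) ((i + 1) * H), |x s - x (i * H)| ≤ w}

/-- The grid itself is the partition: at most `T / H` steps of size `w` lead from `0` to a left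
endpoint, and `⌈T / H⌉₊` cells overshoot `T` by less than `H`. -/
theorem mem_partitionable_of_mem_smallCells {T H : ℝ≥0} {w M : ℝ} {x : CadlagPath} (hH : 0 < H)
    (hx : x ∈ smallCells T H w) (h0 : |x 0| ≤ M) :
    x ∈ partitionable T H w H (M + T / H * w) := by
  have hH' : (0 : ℝ) < H := hH
  have hw : 0 ≤ w := by simpa using hx 0 (by simp) 0 (by simp)
  have bound : ∀ i : ℕ, i * H ≤ T + H → |x (i * H)| ≤ M + i * w := fun i => by
    induction i with
    | zero => intro _; simpa using h0
    | succ i ih =>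
      intro hi
      push_cast at hi ⊢
      have hi' : i * H ≤ T := by
        rw [add_mul, one_mul] at hi
        exact le_of_add_le_add_right hi
      have h1 := ih (hi'.trans (le_add_of_nonneg_right zero_le))
      have h2 := hx i hi' ((i + 1) * H) ⟨by gcongr; simp, le_rfl⟩
      have := abs_add_le (x ((i + 1) * H) - x (i * H)) (x (i * H))
      rw [sub_add_cancel] at this
      linarith
  have hlt : ∀ i < ⌈T / H⌉₊, i * H < T := fun i hi => by
    have := Nat.lt_ceil.1 hi
    rwa [lt_div_iff₀ hH] at this
  refine ⟨⌈T / H⌉₊, fun i => i * H, ⟨by simp, fun i hi => ?_, fun i hi => ?_⟩, ?_⟩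
  · push_cast
    linarith
  · refine ⟨x (i * H), ?_, fun s hs => hx i (hlt i hi).le s ⟨hs.1, by simpa using hs.2.le⟩⟩
    refine (bound i ((hlt i hi).le.trans (le_add_of_nonneg_right zero_le))).trans ?_
    have : (i : ℝ) ≤ T / H := by
      rw [le_div_iff₀ hH']
      exact_mod_cast (hlt i hi).le
    gcongr
  · have h1 : T / H ≤ (⌈T / H⌉₊ : ℝ≥0) := Nat.le_ceil _
    have h2 : (⌈T / H⌉₊ : ℝ≥0) < T / H + 1 := Nat.ceil_lt_add_one zero_le
    have h1 : (T : ℝ) / H ≤ ⌈T / H⌉₊ := by exact_mod_cast h1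
    have h2 : (⌈T / H⌉₊ : ℝ) < T / H + 1 := by exact_mod_cast h2
    rw [div_le_iff₀ hH'] at h1
    have h3 := mul_lt_mul_of_pos_right h2 hH'
    rw [add_mul, div_mul_cancel₀ _ hH'.ne'] at h3
    push_cast
    exact abs_le.2 ⟨by linarith, by linarith⟩

/-- With cells taken half-open on the left, `s` and the times just before it share a cell even when
`s` is a grid point; both values are within `w` of the left endpoint's. -/
theorem notMem_jumpSet_of_mem_smallCells {T H : ℝ≥0} {w ε : ℝ} {x : CadlagPath} (hH : 0 < H)
    (hx : x ∈ smallCells T H w) (hε : 2 * w ≤ ε) : x ∉ jumpSet T ε := by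
  rintro ⟨s, hs, hu⟩
  rcases eq_or_ne s 0 with rfl | h0
  · simp [nhdsWithin] at hu
  have hs0 := pos_iff_ne_zero.2 h0
  obtain ⟨i, -, h1, h2⟩ := NNReal.exists_mem_Ioc_of_le (t := fun i : ℕ => i * H) (N := ⌈s / H⌉₊)
    (by simp) hs0 (by rw [← div_le_iff₀ hH]; exact Nat.le_ceil _)
  push_cast at h2
  refine hu ?_
  filter_upwards [Ioo_mem_nhdsLT h1] with u hu
  have hi : i * H ≤ T := h1.le.trans hs.le
  have a1 := hx i hi s ⟨h1.le, h2⟩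
  have a2 := hx i hi u ⟨hu.1.le, hu.2.le.trans h2⟩
  have := abs_sub_le (x s) (x (i * H)) (x u)
  rw [abs_sub_comm (x (i * H))] at this
  linarith

/-- Chaining over the dyadic multiples of a mesh `r`. -/
theorem mem_smallCells_of_increments {T T' r : ℝ≥0} {R : ℕ} {κ : ℝ} {a : ℕ → ℝ} {x : CadlagPath}
    (hr : 0 < r) (ha : ∀ j, 0 ≤ a j) (hT : T + 2 ^ R * r ≤ T')
    (hinc : ∀ j < R, ∀ k : ℕ, k * (2 ^ j * r) ≤ T' →
      |x (k * (2 ^ j * r) + 2 ^ j * r) - x (k * (2 ^ j * r))| ≤ a j)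
    (hcell : ∀ k : ℕ, k * r ≤ T' → ∀ s ∈ Set.Icc (k * r) (k * r + r), |x s - x (k * r)| ≤ κ) :
    x ∈ smallCells T (2 ^ R * r) (κ + ∑ j ∈ Finset.range R, a j) := by
  -- The level `Q` ancestor of `k` has index `k / 2 ^ Q`. Going up one level leaves the time
  -- unchanged for an even index and costs one increment for an odd one.
  have chain : ∀ Q ≤ R, ∀ k : ℕ, k * r ≤ T' →
      |x (k * r) - x ((k / 2 ^ Q : ℕ) * (2 ^ Q * r))| ≤ ∑ j ∈ Finset.range Q, a j := fun Q => by
    induction Q with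
    | zero => intro _ k _; simp
    | succ Q ih =>
      intro hQ k hk
      have h1 := ih (by lia) k hk
      set m := k / 2 ^ Q
      have hm : (m : ℝ≥0) * (2 ^ Q * r) ≤ T' := by
        refine le_trans ?_ hk
        rw [← mul_assoc]
        gcongr
        exact_mod_cast Nat.div_mul_le_self k (2 ^ Q)
      have hdiv : k / 2 ^ (Q + 1) = m / 2 := by rw [pow_succ, Nat.div_div_eq_div_mul]
      rw [hdiv, Finset.sum_range_succ]
      have h2 : |x (m * (2 ^ Q * r)) - x ((m / 2 : ℕ) * (2 ^ (Q + 1) * r))| ≤ a Q := by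
        rcases Nat.even_or_odd' m with ⟨q, hq | hq⟩
        · have : (m : ℝ≥0) * (2 ^ Q * r) = (m / 2 : ℕ) * (2 ^ (Q + 1) * r) := by
            rw [hq, Nat.mul_div_cancel_left _ two_pos]
            push_cast
            ring
          rw [this, sub_self, abs_zero]
          exact ha Q
        · have e1 : m / 2 = q := by lia
          have e2 : (m : ℝ≥0) * (2 ^ Q * r) = (2 * q : ℕ) * (2 ^ Q * r) + 2 ^ Q * r := by
            rw [hq]
            push_cast
            ring
          have e3 : ((m / 2 : ℕ) : ℝ≥0) * (2 ^ (Q + 1) * r) = (2 * q : ℕ) * (2 ^ Q * r) := by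
            rw [e1]
            push_cast
            ring
          rw [e3, e2]
          refine hinc Q (by lia) _ (le_trans ?_ hm)
          rw [e2]
          exact le_self_add
      have := abs_sub_le (x (k * r)) (x (m * (2 ^ Q * r))) (x ((m / 2 : ℕ) * (2 ^ (Q + 1) * r)))
      linarith
  intro i hi s hs
  -- At the right end of the block the floor of `s / r` would fall in block `i + 1`, so the last
  -- index of block `i` is used instead.
  obtain ⟨k, hk1, hk2, hk3⟩ : ∃ k : ℕ, k / 2 ^ R = i ∧ k * r ≤ s ∧ s ≤ k * r + r := by
    have hpos : 0 < 2 ^ R := by positivity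
    rcases eq_or_lt_of_le hs.2 with h | h
    · refine ⟨i * 2 ^ R + (2 ^ R - 1), ?_, ?_, ?_⟩
      · rw [mul_comm, Nat.mul_add_div hpos, Nat.div_eq_of_lt (by lia), add_zero]
      · rw [h, ← mul_assoc]
        gcongr
        have : i * 2 ^ R + (2 ^ R - 1) ≤ (i + 1) * 2 ^ R := by
          rw [add_mul, one_mul]
          lia
        exact_mod_cast this
      · rw [h, ← mul_assoc, ← add_one_mul]
        gcongr
        have : (i + 1) * 2 ^ R ≤ i * 2 ^ R + (2 ^ R - 1) + 1 := by
          rw [add_mul, one_mul]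
          lia
        exact_mod_cast this
    · refine ⟨⌊s / r⌋₊, ?_, ?_, ?_⟩
      · rw [Nat.div_eq_iff hpos]
        have h1 : i * 2 ^ R ≤ ⌊s / r⌋₊ := by
          rw [Nat.le_floor_iff zero_le, le_div_iff₀ hr]
          push_cast
          rw [mul_assoc]
          exact hs.1
        have h2 : ⌊s / r⌋₊ < (i + 1) * 2 ^ R := by
          rw [Nat.floor_lt zero_le, div_lt_iff₀ hr]
          push_cast
          rw [mul_assoc]
          exact h
        rw [add_mul, one_mul] at h2
        exact ⟨h1, by lia⟩
      · rw [← le_div_iff₀ hr]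
        exact Nat.floor_le zero_le
      · rw [← add_one_mul, ← div_le_iff₀ hr]
        exact (Nat.lt_floor_add_one _).le
  have hkT : k * r ≤ T' := by
    refine (hk2.trans hs.2).trans (le_trans ?_ hT)
    rw [add_mul, one_mul]
    gcongr
  have h1 := chain R le_rfl k hkT
  rw [hk1] at h1
  have h2 := hcell k hkT s ⟨hk2, hk3⟩
  have := abs_sub_le (x s) (x (k * r)) (x (i * (2 ^ R * r)))
  linarith

end CadlagPath

theorem sum_pow_sub_le {ρ : ℝ} (h0 : 0 ≤ ρ) (h1 : ρ < 1) (R : ℕ) :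
    ∑ j ∈ Finset.range R, ρ ^ (R - j) ≤ 1 / (1 - ρ) := by
  have h : (1 - ρ) * ∑ j ∈ Finset.range R, ρ ^ (R - j) = ρ - ρ ^ (R + 1) := by
    induction R with
    | zero => simp
    | succ R ih =>
      rw [Finset.sum_range_succ', mul_add]
      simp only [Nat.add_sub_add_right, ih, Nat.sub_zero]
      ring
  rw [le_div_iff₀ (by linarith), mul_comm, h]
  have : 0 ≤ ρ ^ (R + 1) := pow_nonneg h0 _
  linarith

/-! ### Probability estimates -/

namespace CadlagPath

variable {Ω : Type*} [MeasurableSpace Ω] {μ : Measure Ω}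

/-- Markov's inequality for an increment of a process. -/
theorem measure_lt_abs_increment_le {Y : Ω → CadlagPath} (hY : Measurable Y) {p : ℝ} (hp : 0 < p)
    {t h : ℝ≥0} {B a : ℝ} (ha : 0 < a)
    (hB : ∫⁻ ω, ‖fwdDiff h (Y ω).toFun t‖ₑ ^ p ∂μ ≤ ENNReal.ofReal B) :
    μ {ω | a < |Y ω (t + h) - Y ω t|} ≤ ENNReal.ofReal (B / a ^ p) := by
  have hap : 0 < a ^ p := Real.rpow_pos_of_pos ha p
  have hmeas : AEMeasurable (fun ω => ‖fwdDiff h (Y ω).toFun t‖ₑ ^ p) μ :=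
    ((((measurable_eval (t + h)).comp hY).sub
      ((measurable_eval t).comp hY)).enorm.pow_const p).aemeasurable
  have h1 := meas_ge_le_lintegral_div hmeas (ENNReal.ofReal_pos.2 hap).ne' ENNReal.ofReal_ne_top
  rw [ENNReal.ofReal_div_of_pos hap]
  refine (measure_mono fun ω hω => ?_).trans (h1.trans (ENNReal.div_le_div_right hB _))
  have : ENNReal.ofReal a ≤ ‖fwdDiff h (Y ω).toFun t‖ₑ := by
    rw [Real.enorm_eq_ofReal_abs]
    exact ENNReal.ofReal_le_ofReal (le_of_lt hω)
  change ENNReal.ofReal (a ^ p) ≤ _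
  rw [← ENNReal.ofReal_rpow_of_pos ha]
  exact ENNReal.rpow_le_rpow this hp.le

/-- Kolmogorov's chaining bound down to a mesh `r`. -/
theorem exists_measure_notMem_smallCells_le (T' : ℝ≥0) {K p γ w : ℝ} (hK : 0 ≤ K) (hp : 0 < p)
    (hγ : 1 < γ) (hw : 0 < w) :
    ∃ c : ℝ, ∀ (Y : Ω → CadlagPath), Measurable Y → ∀ (T r : ℝ≥0) (R : ℕ), 0 < r → 2 ^ R * r < 1 →
      T + 2 ^ R * r ≤ T' →
      (∀ h : ℝ≥0, r ≤ h → h < 1 → ∀ t ≤ T',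
        ∫⁻ ω, ‖fwdDiff h (Y ω).toFun t‖ₑ ^ p ∂μ ≤ ENNReal.ofReal (K * (h : ℝ) ^ γ)) →
      μ {ω | Y ω ∉ smallCells T (2 ^ R * r) w} ≤
        μ {ω | ¬ ∀ k : ℕ, k * r ≤ T' → ∀ s ∈ Set.Icc (k * r) (k * r + r),
          |Y ω s - Y ω (k * r)| ≤ w / 2} +
        ENNReal.ofReal (c * ((2 ^ R * r : ℝ≥0) : ℝ) ^ (γ - 1)) := by
  -- The decay `2 ^ (-(γ - 1))` per level is split into two factors `ρ`: one makes the thresholds `a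
  -- j` summable (`q ^ p = ρ`), the other the probabilities.
  set q : ℝ := (1 / 2 : ℝ) ^ ((γ - 1) / (2 * p))
  set ρ : ℝ := (1 / 2 : ℝ) ^ ((γ - 1) / 2)
  have hq0 : 0 < q := by positivity
  have hq1 : q < 1 := Real.rpow_lt_one (by norm_num) (by norm_num)
    (div_pos (by linarith) (by linarith))
  have hρ0 : 0 < ρ := by positivity
  have hρ1 : ρ < 1 := Real.rpow_lt_one (by norm_num) (by norm_num) (by linarith)
  have hqρ : q ^ p = ρ := by
    rw [← Real.rpow_mul (by norm_num)]
    congr 1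
    field_simp
  have hρ2 : (1 / 2 : ℝ) ^ (γ - 1) = ρ * ρ := by
    rw [← Real.rpow_add (by norm_num)]
    congr 1
    ring
  -- The thresholds then sum to at most `w / 2`, whatever `R` is; the other `w / 2` is left for the
  -- oscillation below the mesh.
  set κ : ℝ := w / 2 * (1 - q)
  have hκ : 0 < κ := mul_pos (half_pos hw) (by linarith)
  refine ⟨(T' + 1) * K / κ ^ p * (1 / (1 - ρ)), fun Y hY T r R hr hH hT hmom => ?_⟩
  set H : ℝ≥0 := 2 ^ R * r
  have hH0 : 0 < H := by positivity
  have hH0' : (0 : ℝ) < H := hH0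
  set a : ℕ → ℝ := fun j => κ * q ^ (R - j)
  have ha : ∀ j, 0 < a j := fun j => by positivity
  have hsum : w / 2 + ∑ j ∈ Finset.range R, a j ≤ w := by
    have := mul_le_mul_of_nonneg_left (sum_pow_sub_le hq0.le hq1 R) hκ.le
    rw [Finset.mul_sum] at this
    have h2 : κ * (1 / (1 - q)) = w / 2 := by
      have : 1 - q ≠ 0 := by linarith
      simp only [κ]
      field_simp
    linarith
  set bad : ℕ → ℕ → Set Ω := fun j k =>
    {ω | a j < |Y ω (k * (2 ^ j * r) + 2 ^ j * r) - Y ω (k * (2 ^ j * r))|}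
  set cell : Set Ω := {ω | ¬ ∀ k : ℕ, k * r ≤ T' → ∀ s ∈ Set.Icc (k * r) (k * r + r),
          |Y ω s - Y ω (k * r)| ≤ w / 2}
  have hsub : {ω | Y ω ∉ smallCells T H w} ⊆ cell ∪ ⋃ j ∈ Finset.range R,
      ⋃ k ∈ Finset.range (⌊T' / (2 ^ j * r)⌋₊ + 1), bad j k := by
    intro ω hω
    by_contra hcon
    simp only [Set.mem_union, Set.mem_iUnion, not_or, not_exists, Finset.mem_range] at hcon
    obtain ⟨h1, h2⟩ := hcon
    refine hω ?_
    have := mem_smallCells_of_increments (T := T) (T' := T') (R := R) (κ := w / 2) (x := Y ω) hr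
      (fun j => (ha j).le) hT (fun j hj k hk => ?_) (not_not.1 h1)
    · exact fun i hi s hs => (this i hi s hs).trans hsum
    · refine not_lt.1 (h2 j hj k (Nat.lt_succ_of_le ((Nat.le_floor_iff zero_le).2 ?_)))
      rwa [le_div_iff₀ (by positivity)]
  have level : ∀ j ∈ Finset.range R,
      μ (⋃ k ∈ Finset.range (⌊T' / (2 ^ j * r)⌋₊ + 1), bad j k) ≤
        ENNReal.ofReal ((T' + 1) * K / κ ^ p * (H : ℝ) ^ (γ - 1) * ρ ^ (R - j)) := fun j hj => by
    have hjR : j < R := Finset.mem_range.1 hj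
    set d : ℝ≥0 := 2 ^ j * r
    have hd0 : 0 < d := by positivity
    have hd0' : (0 : ℝ) < d := hd0
    have hdH : (d : ℝ) = H * (1 / 2) ^ (R - j) := by
      have : (2 : ℝ) ^ R = 2 ^ j * 2 ^ (R - j) := by rw [← pow_add]; congr 1; lia
      simp only [d, H]
      push_cast
      rw [this, one_div, inv_pow]
      field_simp
    have hd1 : d < 1 := by
      refine lt_of_le_of_lt ?_ hH
      simp only [d, H]
      gcongr
      · norm_num
    have hrd : r ≤ d := le_mul_of_one_le_left zero_le (one_le_pow₀ one_le_two)
    have each : ∀ k ∈ Finset.range (⌊T' / d⌋₊ + 1),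
        μ (bad j k) ≤ ENNReal.ofReal (K * (d : ℝ) ^ γ / a j ^ p) := fun k hk => by
      refine measure_lt_abs_increment_le hY hp (ha j) (hmom d hrd hd1 _ ?_)
      have := (Nat.le_floor_iff zero_le).1 (Nat.le_of_lt_succ (Finset.mem_range.1 hk))
      rwa [le_div_iff₀ hd0] at this
    refine (measure_biUnion_finset_le _ _).trans ((Finset.sum_le_sum each).trans ?_)
    rw [Finset.sum_const, Finset.card_range, nsmul_eq_mul, ← ENNReal.ofReal_natCast,
      ← ENNReal.ofReal_mul (Nat.cast_nonneg _)]
    refine ENNReal.ofReal_le_ofReal ?_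
    have hcount : ((⌊T' / d⌋₊ + 1 : ℕ) : ℝ) * d ≤ T' + 1 := by
      have h1 : (⌊T' / d⌋₊ : ℝ≥0) * d ≤ T' := by
        rw [← le_div_iff₀ hd0]
        exact Nat.floor_le zero_le
      have h1 : (⌊T' / d⌋₊ : ℝ) * d ≤ T' := by exact_mod_cast h1
      have h2 : (d : ℝ) ≤ 1 := hd1.le
      push_cast
      linarith
    have hdγ : (d : ℝ) ^ γ = d * (d : ℝ) ^ (γ - 1) := by
      rw [Real.rpow_sub_one hd0'.ne']
      field_simp
    have hdγ' : (d : ℝ) ^ (γ - 1) = (H : ℝ) ^ (γ - 1) * (ρ ^ (R - j) * ρ ^ (R - j)) := by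
      rw [hdH, Real.mul_rpow hH0'.le (by positivity), ← Real.rpow_natCast, ← Real.rpow_mul
        (by norm_num), mul_comm (_ : ℝ) (γ - 1), Real.rpow_mul (by norm_num), hρ2,
        Real.rpow_natCast, mul_pow]
    have hap : a j ^ p = κ ^ p * ρ ^ (R - j) := by
      simp only [a]
      rw [Real.mul_rpow hκ.le (by positivity), ← hqρ, ← Real.rpow_natCast, ← Real.rpow_natCast,
        ← Real.rpow_mul hq0.le, ← Real.rpow_mul hq0.le, mul_comm (_ : ℝ) p]
    have hκp : 0 < κ ^ p := Real.rpow_pos_of_pos hκ p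
    -- One factor `d` of `d ^ γ` pays for the number of grid points; dividing the remaining `d ^ (γ
    -- - 1)` by `a j ^ p` leaves one factor `ρ ^ (R - j)`.
    calc ((⌊T' / d⌋₊ + 1 : ℕ) : ℝ) * (K * (d : ℝ) ^ γ / a j ^ p)
        = (((⌊T' / d⌋₊ + 1 : ℕ) : ℝ) * d) *
            (K / κ ^ p * (H : ℝ) ^ (γ - 1) * ρ ^ (R - j)) := by
          rw [hdγ, hdγ', hap]
          field_simp
      _ ≤ (T' + 1) * (K / κ ^ p * (H : ℝ) ^ (γ - 1) * ρ ^ (R - j)) := by gcongr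
      _ = _ := by ring
  refine (measure_mono hsub).trans ((measure_union_le _ _).trans (add_le_add_right ?_ _))
  refine (measure_biUnion_finset_le _ _).trans ((Finset.sum_le_sum level).trans ?_)
  rw [← ENNReal.ofReal_sum_of_nonneg (fun j _ => by positivity), ← Finset.mul_sum]
  refine ENNReal.ofReal_le_ofReal ?_
  calc _ ≤ (T' + 1) * K / κ ^ p * (H : ℝ) ^ (γ - 1) * (1 / (1 - ρ)) :=
        mul_le_mul_of_nonneg_left (sum_pow_sub_le hρ0.le hρ1 R) (by positivity)
    _ = _ := by ring

/-- A control of the cell oscillation bounds the path on each cell of the mesh `n ^ (-θ)`. -/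
theorem abs_sub_le_of_cellOsc_lt {T : ℝ≥0} {θ κ : ℝ} {n : ℕ+} {x : CadlagPath}
    (hx : cellOsc T θ n x < ENNReal.ofReal κ) {k : ℕ} (hk : k * (1 / (n : ℝ≥0) ^ θ) ≤ T) {s : ℝ≥0}
    (hs : s ∈ Set.Icc (k * (1 / (n : ℝ≥0) ^ θ)) (k * (1 / (n : ℝ≥0) ^ θ) + 1 / (n : ℝ≥0) ^ θ)) :
    |x s - x (k * (1 / (n : ℝ≥0) ^ θ))| ≤ κ := by
  have hn : (0 : ℝ≥0) < (n : ℝ≥0) ^ θ := NNReal.rpow_pos (by exact_mod_cast n.pos)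
  have h1 : k ∈ Finset.range (⌊T * (n : ℝ≥0) ^ θ⌋₊ + 1) := by
    rw [Finset.mem_range, Nat.lt_succ_iff, Nat.le_floor_iff zero_le]
    rwa [mul_one_div, div_le_iff₀ hn] at hk
  have h2 : s - k * (1 / (n : ℝ≥0) ^ θ) ∈ Set.Icc (0 : ℝ≥0) (1 / (n : ℝ≥0) ^ θ) :=
    ⟨zero_le, tsub_le_iff_left.2 hs.2⟩
  have h3 : ‖fwdDiff (s - k * (1 / (n : ℝ≥0) ^ θ)) x.toFun ((k : ℝ≥0) / (n : ℝ≥0) ^ θ)‖ₑ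
      ≤ cellOsc T θ n x :=
    le_iSup₂_of_le k h1 (le_iSup₂_of_le _ h2 le_rfl)
  have h4 := h3.trans_lt hx
  rw [fwdDiff, ← mul_one_div (k : ℝ≥0), add_tsub_cancel_of_le hs.1, Real.enorm_eq_ofReal_abs] at h4
  exact (ENNReal.ofReal_lt_ofReal_iff'.1 h4).1.le

/-- For `h ≥ n ^ (-θ)` the factors `n ^ (-a)` are absorbed into powers of `h`. -/
theorem sum_rpow_div_rpow_le {m : ℕ} {a b : Fin m → ℝ} {θ γ : ℝ} (hθ : 0 < θ) (ha : ∀ i, 0 ≤ a i)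
    (hγ : ∀ i, γ ≤ b i + a i / θ) (n : ℕ+) {h : ℝ≥0} (hn : 1 / (n : ℝ≥0) ^ θ ≤ h) (h1 : h < 1) :
    ∑ i, (h : ℝ) ^ b i / (n : ℝ) ^ a i ≤ m * (h : ℝ) ^ γ := by
  have hn0 : (0 : ℝ) < n := by exact_mod_cast n.pos
  have hnθ : 0 < (n : ℝ) ^ θ := Real.rpow_pos_of_pos hn0 θ
  have hn' : 1 / (n : ℝ) ^ θ ≤ h := by exact_mod_cast (NNReal.coe_le_coe.2 hn)
  have hh : (0 : ℝ) < h := lt_of_lt_of_le (by positivity) hn'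
  have each : ∀ i ∈ Finset.univ, (h : ℝ) ^ b i / (n : ℝ) ^ a i ≤ (h : ℝ) ^ γ := fun i _ => by
    have e1 : 1 / (n : ℝ) ^ a i ≤ (h : ℝ) ^ (a i / θ) := by
      refine le_trans (le_of_eq ?_) (Real.rpow_le_rpow (by positivity) hn' (div_nonneg (ha i) hθ.le))
      rw [Real.div_rpow zero_le_one hnθ.le, Real.one_rpow, ← Real.rpow_mul hn0.le,
        mul_div_cancel₀ _ hθ.ne']
    calc (h : ℝ) ^ b i / (n : ℝ) ^ a i = (h : ℝ) ^ b i * (1 / (n : ℝ) ^ a i) := by ring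
      _ ≤ (h : ℝ) ^ b i * (h : ℝ) ^ (a i / θ) := by gcongr
      _ = (h : ℝ) ^ (b i + a i / θ) := (Real.rpow_add hh _ _).symm
      _ ≤ (h : ℝ) ^ γ := Real.rpow_le_rpow_of_exponent_ge hh h1.le (hγ i)
  simpa using Finset.sum_le_sum each

/-- With high probability, uniformly for large `n`, the paths of the process move little on the
cells of a partition whose mesh is of a fixed order. -/
theorem exists_eventually_measure_notMem_smallCells_le {X : ℕ+ → Ω → CadlagPath}
    (hX : ∀ n, Measurable (X n)) {T : ℝ≥0} {θ : ℝ} (hθ : 0 < θ)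
    (hosc : TendstoInMeasure μ (fun (n : ℕ+) ω => cellOsc (T + 1) θ n (X n ω)) atTop (fun _ => 0))
    {C p : ℝ} {m : ℕ} {a b : Fin m → ℝ} (hC : 0 < C) (hp : 0 < p)
    (hab : ∀ i, 0 ≤ a i ∧ 0 < b i ∧ 1 < b i + a i / θ)
    (hmom : ∀ (n : ℕ+) (h : ℝ≥0), 0 < h → h < 1 →
      ⨆ t ∈ Set.Icc 0 (T + 1), ∫⁻ ω, ‖fwdDiff h (X n ω).toFun t‖ₑ ^ p ∂μ ≤
        ENNReal.ofReal (C * ∑ i, (h : ℝ) ^ b i / (n : ℝ) ^ a i))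
    {w : ℝ} (hw : 0 < w) {η : ℝ≥0∞} (hη : 0 < η) {H₀ : ℝ≥0} (hH₀ : 0 < H₀) :
    ∃ δ : ℝ≥0, 0 < δ ∧ ∀ᶠ n in atTop, ∃ H : ℝ≥0, δ ≤ H ∧ H ≤ H₀ ∧
      μ {ω | X n ω ∉ smallCells T H w} ≤ η := by
  obtain ⟨γ, hγ1, hγ⟩ : ∃ γ : ℝ, 1 < γ ∧ ∀ i, γ ≤ b i + a i / θ := by
    have : ∀ᶠ γ : ℝ in 𝓝[>] 1, ∀ i, γ ≤ b i + a i / θ :=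
      eventually_all.2 fun i => nhdsWithin_le_nhds (eventually_le_nhds (hab i).2.2)
    obtain ⟨γ, h1, h2⟩ := (this.and self_mem_nhdsWithin).exists
    exact ⟨γ, h2, h1⟩
  obtain ⟨c, hc⟩ := exists_measure_notMem_smallCells_le (μ := μ) (T + 1) (K := C * m)
    (by positivity) hp hγ1 hw
  have hη2 : 0 < η / 2 := ENNReal.half_pos hη.ne'
  obtain ⟨δ, hδ0, hδ1, hδH, hδ⟩ : ∃ δ : ℝ≥0, 0 < δ ∧ δ < 1 ∧ δ ≤ H₀ ∧
      ∀ H : ℝ≥0, H ≤ δ → ENNReal.ofReal (c * (H : ℝ) ^ (γ - 1)) ≤ η / 2 := by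
    have h1 : Tendsto (fun H : ℝ≥0 => ENNReal.ofReal (c * (H : ℝ) ^ (γ - 1))) (𝓝 0) (𝓝 0) := by
      have : Continuous fun H : ℝ≥0 => ENNReal.ofReal (c * (H : ℝ) ^ (γ - 1)) :=
        ENNReal.continuous_ofReal.comp (continuous_const.mul
          ((Real.continuous_rpow_const (by linarith)).comp NNReal.continuous_coe))
      simpa [Real.zero_rpow (by linarith : γ - 1 ≠ 0)] using this.tendsto 0
    obtain ⟨u, hu, h2⟩ := (mem_nhdsGE_iff_exists_Icc_subset (a := (0 : ℝ≥0))).1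
      (nhdsWithin_le_nhds (h1.eventually_le_const hη2))
    refine ⟨min u (min (1 / 2) H₀), lt_min hu (lt_min (by norm_num) hH₀), ?_, ?_, fun H hH => ?_⟩
    · exact ((min_le_right _ _).trans (min_le_left _ _)).trans_lt (by norm_num)
    · exact (min_le_right _ _).trans (min_le_right _ _)
    · exact h2 ⟨zero_le, hH.trans (min_le_left _ _)⟩
  refine ⟨δ / 2, by positivity, ?_⟩
  have hmesh : ∀ᶠ n : ℕ+ in atTop, 1 / (n : ℝ≥0) ^ θ ≤ δ := by
    have h1 : Tendsto (fun n : ℕ+ => ((n : ℕ) : ℝ)) atTop atTop :=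
      tendsto_natCast_atTop_atTop.comp tendsto_PNat_val_atTop_atTop
    have h2 := ((tendsto_rpow_neg_atTop hθ).comp h1).eventually_le_const
      (show (0 : ℝ) < δ from hδ0)
    filter_upwards [h2] with n hn
    rw [← NNReal.coe_le_coe]
    push_cast
    rwa [one_div, ← Real.rpow_neg (by positivity)]
  have hcell := (hosc (ENNReal.ofReal (w / 2)) (by simpa using hw)).eventually_le_const hη2
  filter_upwards [hmesh, hcell] with n hn hcell
  set r : ℝ≥0 := 1 / (n : ℝ≥0) ^ θ
  have hr : 0 < r := one_div_pos.2 (NNReal.rpow_pos (by exact_mod_cast n.pos))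
  -- `R` is the largest exponent with `2 ^ R * r ≤ δ`, so the mesh `2 ^ R * r` exceeds `δ / 2` for
  -- every such `n`.
  obtain ⟨R, hR1, hR2⟩ := exists_nat_pow_near ((one_le_div hr).2 hn) (one_lt_two (α := ℝ≥0))
  rw [le_div_iff₀ hr] at hR1
  rw [div_lt_iff₀ hr, pow_succ] at hR2
  refine ⟨2 ^ R * r, ?_, hR1.trans hδH, ?_⟩
  · rw [div_le_iff₀ two_pos]
    refine hR2.le.trans (le_of_eq (by ring))
  refine (hc (X n) (hX n) T r R hr (hR1.trans_lt hδ1)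
    (by gcongr; exact (hR1.trans_lt hδ1).le) fun h hrh h1 t ht => ?_).trans ?_
  · refine (le_iSup₂_of_le (f := fun t (_ : t ∈ Set.Icc 0 (T + 1)) =>
      ∫⁻ ω, ‖fwdDiff h (X n ω).toFun t‖ₑ ^ p ∂μ) t ⟨zero_le, ht⟩ le_rfl).trans
      ((hmom n h (hr.trans_le hrh) h1).trans (ENNReal.ofReal_le_ofReal ?_))
    rw [mul_assoc]
    gcongr
    exact sum_rpow_div_rpow_le hθ (fun i => (hab i).1) hγ n hrh h1
  · refine (add_le_add ((measure_mono fun ω hω => ?_).trans hcell) (hδ _ hR1)).trans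
      (ENNReal.add_halves η).le
    change _ ≤ edist _ _
    rw [ENNReal.edist_zero_eq]
    refine not_lt.1 fun hlt => hω fun k hk s hs => abs_sub_le_of_cellOsc_lt hlt hk hs

/-- A moment bound makes the initial values bounded in probability. -/
theorem exists_measure_lt_abs_apply_zero_le {ι : Type*} {X : ι → Ω → CadlagPath}
    (hX : ∀ n, Measurable (X n)) {β : ℝ} (hβ : 0 < β)
    (h0 : ⨆ n, ∫⁻ ω, ‖X n ω 0‖ₑ ^ β ∂μ < ∞) {η : ℝ≥0∞} (hη : 0 < η) :
    ∃ M : ℝ, ∀ n, μ {ω | M < |X n ω 0|} ≤ η := by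
  rcases eq_or_ne η ∞ with rfl | hη'
  · exact ⟨0, fun _ => le_top⟩
  set S := ⨆ n, ∫⁻ ω, ‖X n ω 0‖ₑ ^ β ∂μ
  -- Markov's inequality at level `c` gives `S / c ≤ η`; the added `1` keeps `c` nonzero when `S =
  -- 0`.
  set c : ℝ≥0∞ := S / η + 1
  have hc0 : c ≠ 0 := by simp [c]
  have hct : c ≠ ∞ := ENNReal.add_ne_top.2 ⟨ENNReal.div_ne_top h0.ne hη.ne', ENNReal.one_ne_top⟩
  have hct' : c ^ β⁻¹ ≠ ∞ := ENNReal.rpow_ne_top_of_nonneg (inv_nonneg.2 hβ.le) hct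
  refine ⟨(c ^ β⁻¹).toReal, fun n => ?_⟩
  have hmeas : AEMeasurable (fun ω => ‖X n ω 0‖ₑ ^ β) μ :=
    (((measurable_eval 0).comp (hX n)).enorm.pow_const β).aemeasurable
  refine (measure_mono fun ω hω => ?_).trans ((meas_ge_le_lintegral_div hmeas hc0 hct).trans
    ((ENNReal.div_le_div_right (le_iSup (fun n => ∫⁻ ω, ‖X n ω 0‖ₑ ^ β ∂μ) n) c).trans ?_))
  · change c ≤ _
    have h1 : c ^ β⁻¹ ≤ ‖X n ω 0‖ₑ := by
      rw [Real.enorm_eq_ofReal_abs]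
      exact (ENNReal.le_ofReal_iff_toReal_le hct' (abs_nonneg _)).2 (le_of_lt hω)
    have h2 := ENNReal.rpow_le_rpow h1 hβ.le
    rwa [← ENNReal.rpow_mul, inv_mul_cancel₀ hβ.ne', ENNReal.rpow_one] at h2
  · refine ENNReal.div_le_of_le_mul ?_
    calc S = η * (S / η) := (ENNReal.mul_div_cancel hη.ne' hη').symm
      _ ≤ η * c := by gcongr; exact le_self_add

end CadlagPath

/-! ### The C-tightness theorem -/

open CadlagPath in
theorem lemma3p4 {Ω : Type*} [MeasurableSpace Ω] (μ : Measure Ω) [IsProbabilityMeasure μ]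
    (X : ℕ+ → Ω → CadlagPath) (hX : ∀ n, Measurable (X n))
    (β : ℝ) (hβ : 0 < β)
    (h0 : ⨆ n : ℕ+, ∫⁻ ω, ‖X n ω 0‖ₑ ^ β ∂μ < ∞)
    (h : ∀ T : ℝ≥0, ∃ θ : ℝ, 2 < θ ∧
      TendstoInMeasure μ (fun (n : ℕ+) ω => CadlagPath.cellOsc T θ n (X n ω)) atTop (fun _ => 0) ∧
      ∃ (C p : ℝ) (m : ℕ) (a b : Fin m → ℝ),
        0 < C ∧ 1 ≤ p ∧ 1 ≤ m ∧
        (∀ i, 0 ≤ a i ∧ 0 < b i ∧ 1 < b i + a i / θ) ∧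
        ∀ (n : ℕ+) (h : ℝ≥0), 0 < h → h < 1 →
          ⨆ t ∈ Set.Icc 0 T, ∫⁻ ω, ‖fwdDiff h (X n ω).toFun t‖ₑ ^ p ∂μ ≤
            ENNReal.ofReal (C * ∑ i, (h : ℝ) ^ b i / (n : ℝ) ^ a i)) :
    IsCTight (fun n => pathLaw μ (X n) (hX n)) := by
  have key : ∀ (T : ℝ≥0) {w : ℝ}, 0 < w → ∀ {η : ℝ≥0∞}, 0 < η → ∀ {H₀ : ℝ≥0}, 0 < H₀ →
      ∃ δ : ℝ≥0, 0 < δ ∧ ∀ᶠ n in atTop, ∃ H : ℝ≥0, δ ≤ H ∧ H ≤ H₀ ∧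
        μ {ω | X n ω ∉ smallCells T H w} ≤ η := fun T w hw η hη H₀ hH₀ => by
    -- The extra unit of time accommodates the last cell, which may extend beyond `T`.
    obtain ⟨θ, hθ, hosc, C, p, m, a, b, hC, hp, -, hab, hmom⟩ := h (T + 1)
    exact exists_eventually_measure_notMem_smallCells_le hX (by linarith) hosc hC (by linarith)
      hab hmom hw hη hH₀
  have hlaw : ∀ n {S : Set CadlagPath}, IsOpen S →
      (pathLaw μ (X n) (hX n) : Measure CadlagPath) S = μ (X n ⁻¹' S) := fun n S hS =>
    Measure.map_apply (hX n) hS.measurableSet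
  have hlaw' : ∀ n {S : Set CadlagPath}, IsOpen S →
      (pathLaw μ (X n) (hX n) : Measure CadlagPath) Sᶜ = μ (X n ⁻¹' Sᶜ) := fun n S hS =>
    Measure.map_apply (hX n) hS.measurableSet.compl
  refine ⟨isTightMeasureSet_of_partitionable _ fun T ε hε η hη => ?_, fun φ Q hφ hQ => ?_⟩
  · have hη2 : 0 < η / 2 := ENNReal.half_pos hη.ne'
    obtain ⟨M, hM⟩ := exists_measure_lt_abs_apply_zero_le hX hβ h0 hη2
    -- A mesh of at most `1 / 8` places the last grid point strictly within the tolerance `1 / 4` of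
    -- `T`.
    obtain ⟨δ, hδ, hev⟩ := key T (half_pos hε) hη2 (H₀ := 1 / 8) (by norm_num)
    have hδ' : (0 : ℝ) < δ := hδ
    refine ⟨δ / 2, by positivity, M + T / δ * (ε / 2), ?_⟩
    obtain ⟨n₀, hn₀⟩ := eventually_atTop.1 hev
    refine (Set.finite_Iio n₀).subset fun n hn =>
      Set.mem_Iio.2 (not_le.1 fun hle => hn ?_)
    obtain ⟨H, hδH, hH, hsmall⟩ := hn₀ n hle
    have hδH' : (δ : ℝ) ≤ H := hδH
    have hH' : (H : ℝ) ≤ 1 / 8 := by simpa using NNReal.coe_le_coe.2 hH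
    refine (measure_mono (Set.compl_subset_compl.2 interior_subset)).trans ?_
    rw [hlaw' n isOpen_interior]
    refine (measure_mono fun ω hω => ?_).trans ((measure_union_le _ _).trans
      ((add_le_add hsmall (hM n)).trans (ENNReal.add_halves η).le))
    by_contra hcon
    simp only [Set.mem_union, Set.mem_ofPred_eq, not_or, not_not, not_lt] at hcon
    refine hω (partitionable_subset_interior_of_lt (by positivity) (by linarith) (half_lt_self hε)
      (by linarith) ?_ (mem_partitionable_of_mem_smallCells (hδ.trans_le hδH) hcon.1 hcon.2))
    gcongr
  · refine ae_continuous_of_tendsto hQ fun T ε hε => ?_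
    rw [ENNReal.tendsto_nhds_zero]
    intro η hη
    -- Cells of oscillation `ε / 4` exclude jumps above `ε / 2`, and `jumpSet T ε` lies in the
    -- interior of that larger jump set.
    obtain ⟨δ, hδ, hev⟩ := key T (w := ε / 4) (by positivity) hη one_pos
    have hφ' : Tendsto φ atTop atTop := tendsto_atTop_atTop_of_monotone hφ.monotone fun n =>
      ⟨n, PNat.coe_le_coe _ _ |>.1 <|
        StrictMono.le_apply (f := fun j => (φ j : ℕ)) fun _ _ hij => hφ hij⟩
    filter_upwards [hφ'.eventually hev] with j hj
    obtain ⟨H, hδH, -, hsmall⟩ := hj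
    refine (measure_mono (jumpSet_subset_interior T (half_lt_self hε))).trans ?_
    rw [hlaw _ isOpen_interior]
    refine (measure_mono fun ω hω hmem => ?_).trans hsmall
    exact notMem_jumpSet_of_mem_smallCells (hδ.trans_le hδH) hmem (by linarith)
      (interior_subset hω)
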